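/- Let $(E_i,\Phi_i)$, $1\le i\le r$, $r\ge 1$, be CM types ($E_i$ a CM field, $\Phi_i\subset \mathrm{Hom}(E_i,\mathbb C)$ with $\Phi_i\cup\iota\Phi_i=\mathrm{Hom}(E_i,\mathbb C)$ and $\Phi_i\cap\iota\Phi_i=\emptyset$, where $\iota$ is complex conjugation); in particular, they may be the ones chosen to construct the symplectic space of a CM field $E$. For each $i$ let $\xi_i$ be a totally imaginary generator of $E_i$ over $\mathbb Q$ (so $E_i=\mathbb Q(\xi_i)$ and $\xi_i^\iota=-\xi_i$), and assume that the numbers $\mathrm{Im}\,\varphi(\xi_i)$, for $1\le i\le r$ and $\varphi\in\Phi_i$, are all positive or all negative. Put $$V_E=\bigoplus_i E_i,\qquad \psi_E(x,y)=\sum_i \mathrm{Tr}_{E_i/\mathbb Q}(\xi_i x_i y_i^\iota),\qquad L_E=\bigoplus_i\mathcal O_{E_i}.$$ For a $\mathbb Q$-algebra $R$ let $MSp(R)$ be the monoid of all $f\in \mathrm{End}_R(V_E\otimes R)$ for which there is $\nu\in R$ with $\psi_E(fx,fy)=\nu\,\psi_E(x,y)$ for all $x,y$, and let $GSp(R)$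 be the group of the automorphisms $f$ for which this holds with some $\nu\in R^\times$. Let $GSp(\mathbb R)^+$ be the identity component of $GSp(\mathbb R)$ and $GSp(\mathbb Q)^+=GSp(\mathbb Q)\cap GSp(\mathbb R)^+$. Let $\Gamma_M=\{f\in MSp(\mathbb A_f): f(L_E\otimes\widehat{\mathbb Z})\subset L_E\otimes\widehat{\mathbb Z}\}$, let $\Gamma_{Sh}=\{g\in GSp(\mathbb A_f): g,g^{-1}\in\Gamma_M\}$ and $\Gamma_{Sh}^+=\Gamma_{Sh}\cap GSp(\mathbb Q)^+$. Let $h_{cm}:\mathbb S(\mathbb R)=\mathbb C^\times\to GSp(\mathbb R)$ send $z$ to multiplication by the element of $\prod_i E_i\otimes\mathbb R\cong\prod_i\prod_{\varphi\in\Phi_i}\mathbb C$ all of whose coordinates are $z$. Let $X$ be its $GSp(\mathbb R)$-conjugacy class, with the topology of a homogeneous space of $GSp(\mathbb R)$, and let $X^+$ be the connected component of $X$ that contains $h_{cm}$. Let $Sh=GSp(\mathbb Q)\backslash(X\times GSp(\mathbb A_f))$, and define $$U_{Sh}=\{(g,\rho,[x,l])\in GSp(\mathbb A_f)\times\Gamma_M\times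 Sh : g\rho\in\Gamma_M\},\qquad Z_{Sh}=(\Gamma_{Sh}\times\Gamma_{Sh})\backslash U_{Sh},$$ $$U^+_{Sh}=\{(g,\rho,x)\in GSp(\mathbb Q)^+\times\Gamma_M\times X^+ : g\rho\in\Gamma_M\},\qquad Z^+_{Sh}=(\Gamma^+_{Sh}\times\Gamma^+_{Sh})\backslash U^+_{Sh},$$ for the actions $(\gamma_1,\gamma_2)(g,\rho,[x,l])=(\gamma_1g\gamma_2^{-1},\gamma_2\rho,[x,l\gamma_2^{-1}])$ and $(\gamma_1,\gamma_2)(g,\rho,x)=(\gamma_1g\gamma_2^{-1},\gamma_2\rho,\gamma_2x)$. Here $GSp(\mathbb Q)$ is discrete, $GSp(\mathbb A_f)$ and $\Gamma_M$ carry the adelic topology, and quotients carry the quotient topology. Then: 1. $GSp(\mathbb A_f)=GSp(\mathbb Q)\cdot\Gamma_{Sh}$; 2. the natural map $GSp(\mathbb Q)\cap\Gamma_{Sh}\to GSp(\mathbb Q)/GSp(\mathbb Q)^+$ is surjective; 3. the map $Z^+_{Sh}\to Z_{Sh}$ induced by $(g,\rho,x)\mapsto(g,\rho,[x,1])$ is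 a homeomorphism. -/

import Mathlib

open scoped TensorProduct
open NumberField

noncomputable section

namespace ShimuraBCM

/-- The ring `𝔸_f` of finite adeles of `ℚ`. -/
abbrev FinAdele : Type := IsDedekindDomain.FiniteAdeleRing ℤ ℚ

/-! ### Similitude monoids and groups of a bilinear form -/

section Similitudes

variable {R M : Type*} [CommRing R] [AddCommGroup M] [Module R M]

/-- The monoid `MSp` of a module with a bilinear form: the endomorphisms `f` with
`B (f x) (f y) = ν * B x y` for some `ν` in the ground ring. -/
def MSp (B : LinearMap.BilinForm R M) : Submonoid (Module.End R M) where
  carrier := {f | ∃ ν : R, ∀ x y, B (f x) (f y) = ν * B x y}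
  one_mem' := ⟨1, fun x y => by simp⟩
  mul_mem' := by
    rintro f g ⟨ν, hν⟩ ⟨μ, hμ⟩
    exact ⟨ν * μ, fun x y => by simp only [Module.End.mul_apply, hν, hμ, mul_assoc]⟩

/-- The group `GSp` of a module with a bilinear form: the automorphisms `f` with
`B (f x) (f y) = ν * B x y` for some unit `ν` of the ground ring. -/
def GSp (B : LinearMap.BilinForm R M) : Subgroup (Module.End R M)ˣ where
  carrier := {f | ∃ ν : Rˣ, ∀ x y,
    B ((f : Module.End R M) x) ((f : Module.End R M) y) = (ν : R) * B x y}
  one_mem' := ⟨1, fun x y => by simp⟩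
  mul_mem' := by
    rintro f g ⟨ν, hν⟩ ⟨μ, hμ⟩
    exact ⟨ν * μ, fun x y => by
      simp only [Units.val_mul, Module.End.mul_apply, hν, hμ, mul_assoc]⟩
  inv_mem' := by
    rintro f ⟨ν, hν⟩
    refine ⟨ν⁻¹, fun x y => ?_⟩
    have key : ∀ z, (f : Module.End R M) (((f⁻¹ : (Module.End R M)ˣ) : Module.End R M) z) = z :=
      fun z => by rw [← Module.End.mul_apply, Units.mul_inv, Module.End.one_apply]
    have := hν (((f⁻¹ : (Module.End R M)ˣ) : Module.End R M) x)
      (((f⁻¹ : (Module.End R M)ˣ) : Module.End R M) y)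
    rw [key, key] at this
    rw [this, Units.inv_mul_cancel_left]

lemma coe_mem_MSp {B : LinearMap.BilinForm R M} (g : GSp B) :
    ((g : (Module.End R M)ˣ) : Module.End R M) ∈ MSp B := by
  obtain ⟨ν, hν⟩ := g.2
  exact ⟨ν, hν⟩

lemma baseChange_mem_GSp (A : Type*) [CommRing A] [Algebra R A]
    (B : LinearMap.BilinForm R M) (g : GSp B) :
    Units.map (Module.End.baseChangeHom R A M : Module.End R M →* Module.End A (A ⊗[R] M))
      (g : (Module.End R M)ˣ) ∈ GSp (B.baseChange A) := by
  obtain ⟨ν, hν⟩ := g.2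
  refine ⟨Units.map (algebraMap R A : R →* A) ν, fun x y => ?_⟩
  induction x using TensorProduct.induction_on with
  | zero => simp
  | add x₁ x₂ h₁ h₂ => simp only [map_add, LinearMap.add_apply, h₁, h₂, mul_add]
  | tmul a m =>
    induction y using TensorProduct.induction_on with
    | zero => simp
    | add y₁ y₂ h₁ h₂ => simp only [map_add, h₁, h₂, mul_add]
    | tmul b n =>
      change B.baseChange A (a ⊗ₜ[R] ((g : (Module.End R M)ˣ) : Module.End R M) m)
        (b ⊗ₜ[R] ((g : (Module.End R M)ˣ) : Module.End R M) n) = algebraMap R A ν * _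
      simp only [LinearMap.BilinForm.baseChange_tmul, hν, Algebra.smul_def, map_mul, mul_assoc]

/-- The group homomorphism `GSp(R) → GSp(A)` induced by an algebra `R → A`. -/
def GSp.toBaseChange (A : Type*) [CommRing A] [Algebra R A]
    (B : LinearMap.BilinForm R M) : GSp B →* GSp (B.baseChange A) :=
  ((Units.map (Module.End.baseChangeHom R A M : Module.End R M →* Module.End A (A ⊗[R] M))).comp
    (GSp B).subtype).codRestrict _ (baseChange_mem_GSp A B)

end Similitudes

/-! ### The topology on endomorphisms of `A ⊗ V` -/

section Topology

variable (V : Type*) [AddCommGroup V] [Module ℚ V]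
variable (A : Type*) [CommRing A] [Algebra ℚ A] [TopologicalSpace A]

/-- For a topological ring `A` and a finite-dimensional `V`, the free `A`-module
`End_A (A ⊗ V)` carries its canonical topology (the product topology in any basis). -/
instance endTopologicalSpace : TopologicalSpace (Module.End A (A ⊗[ℚ] V)) := moduleTopology A _

instance endIsModuleTopology : IsModuleTopology A (Module.End A (A ⊗[ℚ] V)) := ⟨rfl⟩

instance endIsTopologicalRing [IsTopologicalRing A] [Module.Finite ℚ V] :
    IsTopologicalRing (Module.End A (A ⊗[ℚ] V)) :=
  IsModuleTopology.isTopologicalRing A _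

instance endContinuousMul [IsTopologicalRing A] [Module.Finite ℚ V] :
    ContinuousMul (Module.End A (A ⊗[ℚ] V)) :=
  (endIsTopologicalRing V A).toContinuousMul

lemma isTopologicalGroup_subgroup (G : Type*) [Group G] [TopologicalSpace G]
    [IsTopologicalGroup G] (H : Subgroup G) : IsTopologicalGroup H := inferInstance

instance GSp.isTopologicalGroup [IsTopologicalRing A] [Module.Finite ℚ V]
    (ψ : LinearMap.BilinForm ℚ V) : IsTopologicalGroup (GSp (ψ.baseChange A)) :=
  isTopologicalGroup_subgroup (Module.End A (A ⊗[ℚ] V))ˣ (GSp (ψ.baseChange A))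

end Topology

/-! ### The groupoids attached to a symplectic space with a lattice and a morphism `h`

Throughout, `V` is a finite-dimensional rational vector space with a bilinear form `ψ`, `L` is a
lattice in `V`, and `h : ℂˣ = 𝕊(ℝ) → GSp(ℝ)` is (the map on real points of) a morphism of real
algebraic groups; such a morphism is determined by its effect on real points. -/

section Groupoids

set_option linter.unusedSectionVars false

variable {V : Type*} [AddCommGroup V] [Module ℚ V] [Module.Finite ℚ V]
variable (ψ : LinearMap.BilinForm ℚ V) (L : AddSubgroup V)

/-- `GSp(ℚ)`. -/
def GQ : Type _ := GSp ψ

/-- `GSp(ℝ)`, with its real topology. -/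
def GR : Type _ := GSp (ψ.baseChange ℝ)

/-- `GSp(𝔸_f)`, with its adelic topology. -/
def GAf : Type _ := GSp (ψ.baseChange FinAdele)

instance GQ.group : Group (GQ ψ) := inferInstanceAs (Group (GSp ψ))
instance GR.group : Group (GR ψ) := inferInstanceAs (Group (GSp (ψ.baseChange ℝ)))
instance GAf.group : Group (GAf ψ) := inferInstanceAs (Group (GSp (ψ.baseChange FinAdele)))

/-- `GSp(ℚ)` is regarded as a discrete group. -/
instance GQ.topologicalSpace : TopologicalSpace (GQ ψ) := ⊥
instance GQ.discreteTopology : DiscreteTopology (GQ ψ) := ⟨rfl⟩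

instance GR.topologicalSpace : TopologicalSpace (GR ψ) :=
  inferInstanceAs (TopologicalSpace (GSp (ψ.baseChange ℝ)))
instance GR.isTopologicalGroup : IsTopologicalGroup (GR ψ) :=
  GSp.isTopologicalGroup V ℝ ψ
instance GAf.topologicalSpace : TopologicalSpace (GAf ψ) :=
  inferInstanceAs (TopologicalSpace (GSp (ψ.baseChange FinAdele)))
instance GAf.isTopologicalGroup : IsTopologicalGroup (GAf ψ) :=
  GSp.isTopologicalGroup V FinAdele ψ

/-- The embedding `GSp(ℚ) → GSp(ℝ)`. -/
def toReal : GQ ψ →* GR ψ := GSp.toBaseChange ℝ ψ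

/-- The embedding `GSp(ℚ) → GSp(𝔸_f)`. -/
def toAdelic : GQ ψ →* GAf ψ := GSp.toBaseChange FinAdele ψ

/-- The inclusion `φ : GSp(𝔸_f) → End(V ⊗ 𝔸_f)`. -/
def GAf.toEnd : GAf ψ →* Module.End FinAdele (FinAdele ⊗[ℚ] V) :=
  (Units.coeHom _).comp (GSp (ψ.baseChange FinAdele)).subtype

/-- `GSp(ℚ)⁺ = GSp(ℚ) ∩ GSp(ℝ)⁺`, with `GSp(ℝ)⁺` the identity component of `GSp(ℝ)`. -/
def GQplus : Subgroup (GQ ψ) := (Subgroup.connectedComponentOfOne (GR ψ)).comap (toReal ψ)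

/-- The image of `L ⊗ ℤ̂` in `𝔸_f ⊗ V`, where `ℤ̂` is the ring of adeles integral at all primes. -/
def adelicLattice : AddSubgroup (FinAdele ⊗[ℚ] V) :=
  AddSubgroup.closure {t | ∃ a : FinAdele, (∀ p, a p ∈ p.adicCompletionIntegers ℚ) ∧
    ∃ x ∈ L, t = a ⊗ₜ[ℚ] x}

/-- The semigroup `Γ_M = MSp(𝔸_f) ∩ End(L ⊗ ℤ̂)` of the maximal level structure. -/
def GammaM : Submonoid (Module.End FinAdele (FinAdele ⊗[ℚ] V)) where
  carrier := {f | f ∈ MSp (ψ.baseChange FinAdele) ∧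
    ∀ t ∈ adelicLattice L, f t ∈ adelicLattice L}
  one_mem' := ⟨one_mem _, fun _ ht => ht⟩
  mul_mem' := fun hf hg => ⟨mul_mem hf.1 hg.1, fun t ht => hf.2 _ (hg.2 t ht)⟩

/-- The group `Γ = φ⁻¹(Γ_M^×)` of the maximal level structure. -/
def Gamma : Subgroup (GAf ψ) where
  carrier := {g | GAf.toEnd ψ g ∈ GammaM ψ L ∧ GAf.toEnd ψ g⁻¹ ∈ GammaM ψ L}
  one_mem' := by
    simp only [Set.mem_ofPred_eq, inv_one, map_one]
    exact ⟨one_mem _, one_mem _⟩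
  mul_mem' := by
    rintro a b ⟨ha, ha'⟩ ⟨hb, hb'⟩
    refine ⟨?_, ?_⟩
    · rw [map_mul]; exact mul_mem ha hb
    · rw [mul_inv_rev, map_mul]; exact mul_mem hb' ha'
  inv_mem' := by
    rintro a ⟨ha, ha'⟩
    exact ⟨ha', by rwa [inv_inv]⟩

/-- `Γ⁺ = Γ ∩ GSp(ℚ)⁺`, as a subgroup of `GSp(ℚ)⁺`. -/
def GammaPlus : Subgroup (GQplus ψ) :=
  (Gamma ψ L).comap ((toAdelic ψ).comp (GQplus ψ).subtype)

variable {ψ} (h : ℂˣ →* GR ψ)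

/-- The `GSp(ℝ)`-conjugacy class `X` of `h`. -/
def X : Type _ := {x : ℂˣ →* GR ψ // ∃ g : GR ψ, x = (MulAut.conj g).toMonoidHom.comp h}

/-- The orbit map `GSp(ℝ) → X`, `g ↦ g h g⁻¹`. -/
def X.ofGroup (g : GR ψ) : X h := ⟨(MulAut.conj g).toMonoidHom.comp h, g, rfl⟩

/-- The base point `h` of `X`. -/
def X.base : X h := ⟨h, 1, by ext; simp⟩

/-- `X` carries the topology of a homogeneous space of `GSp(ℝ)`. -/
instance X.topologicalSpace : TopologicalSpace (X h) := .coinduced (X.ofGroup h) inferInstance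

/-- `GSp(ℝ)` acts on `X` by conjugation, `g · x = g x g⁻¹`. -/
instance X.mulActionGR : MulAction (GR ψ) (X h) where
  smul g x := ⟨(MulAut.conj g).toMonoidHom.comp x.1, by
    obtain ⟨k, hk⟩ := x.2
    exact ⟨g * k, by rw [hk]; ext z; simp⟩⟩
  one_smul x := Subtype.ext (by
    change (MulAut.conj (1 : GR ψ)).toMonoidHom.comp x.1 = x.1
    ext z; simp)
  mul_smul a b x := Subtype.ext (by
    change (MulAut.conj (a * b)).toMonoidHom.comp x.1 =
      (MulAut.conj a).toMonoidHom.comp ((MulAut.conj b).toMonoidHom.comp x.1)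
    ext z; simp)

instance X.mulActionGQ : MulAction (GQ ψ) (X h) := MulAction.compHom (X h) (toReal ψ)

instance GAf.mulActionGQ : MulAction (GQ ψ) (GAf ψ) := MulAction.compHom (GAf ψ) (toAdelic ψ)

/-- The Shimura variety `Sh = GSp(ℚ) \ (X × GSp(𝔸_f))`, with `q (x, l) = (q x, q l)`. -/
def Sh : Type _ := MulAction.orbitRel.Quotient (GQ ψ) (X h × GAf ψ)

instance Sh.topologicalSpace : TopologicalSpace (Sh h) :=
  inferInstanceAs (TopologicalSpace (Quotient (MulAction.orbitRel (GQ ψ) (X h × GAf ψ))))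

/-- The class `[x, l]`. -/
def Sh.mk (x : X h) (l : GAf ψ) : Sh h :=
  Quotient.mk (MulAction.orbitRel (GQ ψ) (X h × GAf ψ)) (x, l)

lemma Sh.mk_smul (q : GQ ψ) (x : X h) (l : GAf ψ) :
    Sh.mk h (q • x) (toAdelic ψ q * l) = Sh.mk h x l :=
  Quotient.sound (s := MulAction.orbitRel (GQ ψ) (X h × GAf ψ)) ⟨q, rfl⟩

/-- The right action `[x, l] g = [x, l g]` of `GSp(𝔸_f)` on `Sh`, written as a left action of
`g⁻¹`: the element `g` sends `[x, l]` to `[x, l g⁻¹]`. -/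
instance Sh.mulAction : MulAction (GAf ψ) (Sh h) where
  smul g := Quotient.map (fun p => (p.1, p.2 * g⁻¹)) (by
    rintro _ ⟨x, l⟩ ⟨q, rfl⟩
    exact ⟨q, Prod.ext rfl (mul_assoc (toAdelic ψ q) l g⁻¹).symm⟩)
  one_smul s := by
    induction s using Quotient.inductionOn with
    | _ p =>
      refine congrArg (Quotient.mk _) (Prod.ext rfl ?_)
      change p.2 * (1 : GAf ψ)⁻¹ = p.2
      simp
  mul_smul a b s := by
    induction s using Quotient.inductionOn with
    | _ p =>
      refine congrArg (Quotient.mk _) (Prod.ext rfl ?_)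
      change p.2 * (a * b)⁻¹ = p.2 * b⁻¹ * a⁻¹
      simp [mul_assoc]

lemma Sh.smul_mk (g : GAf ψ) (x : X h) (l : GAf ψ) :
    g • Sh.mk h x l = Sh.mk h x (l * g⁻¹) := rfl

/-- The BCM groupoid `U = GSp(𝔸_f) ⊞ (Γ_M × Sh)`: the triples `(g, ρ, s)` with `g ρ ∈ Γ_M`. -/
def U : Type _ := {u : GAf ψ × GammaM ψ L × Sh h //
  GAf.toEnd ψ u.1 * (u.2.1 : Module.End FinAdele (FinAdele ⊗[ℚ] V)) ∈ GammaM ψ L}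

instance U.topologicalSpace : TopologicalSpace (U L h) := instTopologicalSpaceSubtype

/-- An element of `Γ` as an element of `Γ_M`. -/
def Gamma.toGammaM : Gamma ψ L →* GammaM ψ L :=
  ((GAf.toEnd ψ).comp (Gamma ψ L).subtype).codRestrict _ (fun γ => γ.2.1)

/-- `(γ₁, γ₂) (g, ρ, [x, l]) = (γ₁ g γ₂⁻¹, γ₂ ρ, [x, l γ₂⁻¹])`. -/
instance U.mulAction : MulAction (Gamma ψ L × Gamma ψ L) (U L h) where
  smul γ u := ⟨((γ.1 : GAf ψ) * u.1.1 * (γ.2 : GAf ψ)⁻¹,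
      Gamma.toGammaM L γ.2 * u.1.2.1, (γ.2 : GAf ψ) • u.1.2.2), by
    have e : GAf.toEnd ψ ((γ.1 : GAf ψ) * u.1.1 * (γ.2 : GAf ψ)⁻¹) *
        ((Gamma.toGammaM L γ.2 * u.1.2.1 : GammaM ψ L) :
          Module.End FinAdele (FinAdele ⊗[ℚ] V)) =
        GAf.toEnd ψ (γ.1 : GAf ψ) * (GAf.toEnd ψ u.1.1 * u.1.2.1) := by
      change _ * (GAf.toEnd ψ (γ.2 : GAf ψ) * _) = _
      rw [← mul_assoc, ← map_mul, inv_mul_cancel_right, map_mul, mul_assoc]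
    rw [e]
    exact mul_mem γ.1.2.1 u.2⟩
  one_smul u := by
    refine Subtype.ext (Prod.ext ?_ (Prod.ext ?_ ?_))
    · change (1 : GAf ψ) * u.1.1 * (1 : GAf ψ)⁻¹ = u.1.1
      simp
    · change Gamma.toGammaM L 1 * u.1.2.1 = u.1.2.1
      simp
    · exact one_smul (GAf ψ) u.1.2.2
  mul_smul a b u := by
    refine Subtype.ext (Prod.ext ?_ (Prod.ext ?_ ?_))
    · change ((a.1 : GAf ψ) * b.1) * u.1.1 * ((a.2 : GAf ψ) * b.2)⁻¹ =
        (a.1 : GAf ψ) * ((b.1 : GAf ψ) * u.1.1 * (b.2 : GAf ψ)⁻¹) * (a.2 : GAf ψ)⁻¹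
      simp [mul_assoc]
    · change Gamma.toGammaM L (a.2 * b.2) * u.1.2.1 =
        Gamma.toGammaM L a.2 * (Gamma.toGammaM L b.2 * u.1.2.1)
      rw [map_mul, mul_assoc]
    · exact mul_smul (a.2 : GAf ψ) (b.2 : GAf ψ) u.1.2.2

/-- `Z = (Γ × Γ) \ U`, with the quotient topology. -/
def Z : Type _ := Quotient (MulAction.orbitRel (Gamma ψ L × Gamma ψ L) (U L h))

instance Z.topologicalSpace : TopologicalSpace (Z L h) := instTopologicalSpaceQuotient

/-- The connected component `X⁺` of `X` that contains `h`. -/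
def Xplus : Set (X h) := connectedComponent (X.base h)

lemma continuous_smul_const (x : X h) : Continuous fun g : GR ψ => g • x := by
  obtain ⟨k, hk⟩ := x.2
  have e : (fun g : GR ψ => g • x) = X.ofGroup h ∘ fun g => g * k := by
    funext g
    refine Subtype.ext ?_
    change (MulAut.conj g).toMonoidHom.comp x.1 = (MulAut.conj (g * k)).toMonoidHom.comp h
    rw [hk]; ext z; simp
  rw [e]
  exact continuous_coinduced_rng.comp (continuous_mul_const k)

lemma smul_mem_Xplus (q : GQplus ψ) (x : Xplus h) : (q : GQ ψ) • (x : X h) ∈ Xplus h := by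
  have hsub : (fun g : GR ψ => g • (x : X h)) '' connectedComponent 1 ⊆
      connectedComponent (x : X h) := by
    refine IsPreconnected.subset_connectedComponent
      (isPreconnected_connectedComponent.image _ (continuous_smul_const h _).continuousOn) ?_
    exact ⟨1, mem_connectedComponent, one_smul _ _⟩
  have := hsub ⟨toReal ψ q, q.2, rfl⟩
  rwa [← connectedComponent_eq x.2] at this

/-- `GSp(ℚ)⁺` acts on `X⁺`. -/
instance Xplus.mulAction : MulAction (GQplus ψ) (Xplus h) where
  smul q x := ⟨(q : GQ ψ) • (x : X h), smul_mem_Xplus h q x⟩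
  one_smul x := Subtype.ext (one_smul (GQ ψ) (x : X h))
  mul_smul a b x := Subtype.ext (mul_smul (a : GQ ψ) (b : GQ ψ) (x : X h))

/-- The positive groupoid `U⁺ = GSp(ℚ)⁺ ⊞ (Γ_M × X⁺)`: the triples `(g, ρ, x)` with
`g ρ ∈ Γ_M`. -/
def Uplus : Type _ := {u : GQplus ψ × GammaM ψ L × Xplus h //
  GAf.toEnd ψ (toAdelic ψ u.1) * (u.2.1 : Module.End FinAdele (FinAdele ⊗[ℚ] V)) ∈ GammaM ψ L}

instance Uplus.topologicalSpace : TopologicalSpace (Uplus L h) := instTopologicalSpaceSubtype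

/-- The inclusion `Γ⁺ → Γ`. -/
def GammaPlus.toGamma : GammaPlus ψ L →* Gamma ψ L :=
  (((toAdelic ψ).comp (GQplus ψ).subtype).comp (GammaPlus ψ L).subtype).codRestrict _
    (fun γ => γ.2)

/-- `(γ₁, γ₂) (g, ρ, x) = (γ₁ g γ₂⁻¹, γ₂ ρ, γ₂ x)`. -/
instance Uplus.mulAction :
    MulAction (GammaPlus ψ L × GammaPlus ψ L) (Uplus L h) where
  smul γ u := ⟨((γ.1 : GQplus ψ) * u.1.1 * (γ.2 : GQplus ψ)⁻¹,
      Gamma.toGammaM L (GammaPlus.toGamma L γ.2) * u.1.2.1, (γ.2 : GQplus ψ) • u.1.2.2), by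
    have e : GAf.toEnd ψ (toAdelic ψ
          (((γ.1 : GQplus ψ) * u.1.1 * (γ.2 : GQplus ψ)⁻¹ : GQplus ψ) : GQ ψ)) *
        ((Gamma.toGammaM L (GammaPlus.toGamma L γ.2) * u.1.2.1 : GammaM ψ L) :
          Module.End FinAdele (FinAdele ⊗[ℚ] V)) =
        GAf.toEnd ψ (toAdelic ψ ((γ.1 : GQplus ψ) : GQ ψ)) *
          (GAf.toEnd ψ (toAdelic ψ (u.1.1 : GQ ψ)) * u.1.2.1) := by
      change _ * (GAf.toEnd ψ (toAdelic ψ ((γ.2 : GQplus ψ) : GQ ψ)) * _) = _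
      rw [← mul_assoc, ← map_mul, ← map_mul, ← Subgroup.coe_mul, inv_mul_cancel_right,
        Subgroup.coe_mul, map_mul, map_mul, mul_assoc]
    rw [e]
    exact mul_mem (GammaPlus.toGamma L γ.1).2.1 u.2⟩
  one_smul u := by
    refine Subtype.ext (Prod.ext ?_ (Prod.ext ?_ ?_))
    · change (1 : GQplus ψ) * u.1.1 * (1 : GQplus ψ)⁻¹ = u.1.1
      simp
    · change Gamma.toGammaM L (GammaPlus.toGamma L 1) * u.1.2.1 = u.1.2.1
      simp
    · exact one_smul (GQplus ψ) u.1.2.2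
  mul_smul a b u := by
    refine Subtype.ext (Prod.ext ?_ (Prod.ext ?_ ?_))
    · change ((a.1 : GQplus ψ) * b.1) * u.1.1 * ((a.2 : GQplus ψ) * b.2)⁻¹ =
        (a.1 : GQplus ψ) * ((b.1 : GQplus ψ) * u.1.1 * (b.2 : GQplus ψ)⁻¹) * (a.2 : GQplus ψ)⁻¹
      simp [mul_assoc]
    · change Gamma.toGammaM L (GammaPlus.toGamma L (a.2 * b.2)) * u.1.2.1 =
        Gamma.toGammaM L (GammaPlus.toGamma L a.2) *
          (Gamma.toGammaM L (GammaPlus.toGamma L b.2) * u.1.2.1)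
      rw [map_mul, map_mul, mul_assoc]
    · exact mul_smul (a.2 : GQplus ψ) (b.2 : GQplus ψ) u.1.2.2

/-- `Z⁺ = (Γ⁺ × Γ⁺) \ U⁺`, with the quotient topology. -/
def Zplus : Type _ := Quotient (MulAction.orbitRel (GammaPlus ψ L × GammaPlus ψ L) (Uplus L h))

instance Zplus.topologicalSpace : TopologicalSpace (Zplus L h) := instTopologicalSpaceQuotient

/-- The natural morphism `U⁺ → U`, `(g, ρ, x) ↦ (g, ρ, [x, 1])`. -/
def naturalU (u : Uplus L h) : U L h :=
  ⟨(toAdelic ψ u.1.1, u.1.2.1, Sh.mk h u.1.2.2 1), u.2⟩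

lemma naturalU_smul (γ : GammaPlus ψ L × GammaPlus ψ L) (u : Uplus L h) :
    naturalU L h (γ • u) =
      (GammaPlus.toGamma L γ.1, GammaPlus.toGamma L γ.2) • naturalU L h u := by
  refine Subtype.ext (Prod.ext ?_ (Prod.ext rfl ?_))
  · change toAdelic ψ (((γ.1 : GQplus ψ) * u.1.1 * (γ.2 : GQplus ψ)⁻¹ : GQplus ψ) : GQ ψ) =
      toAdelic ψ ((γ.1 : GQplus ψ) : GQ ψ) * toAdelic ψ (u.1.1 : GQ ψ) *
        (toAdelic ψ ((γ.2 : GQplus ψ) : GQ ψ))⁻¹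
    simp
  · change Sh.mk h (((γ.2 : GQplus ψ) : GQ ψ) • (u.1.2.2 : X h)) 1 =
      Sh.mk h u.1.2.2 (1 * (toAdelic ψ ((γ.2 : GQplus ψ) : GQ ψ))⁻¹)
    rw [← Sh.mk_smul h ((γ.2 : GQplus ψ) : GQ ψ) (u.1.2.2 : X h)]
    simp

/-- The map `Z⁺ → Z` induced by the natural morphism `U⁺ → U`. -/
def naturalZ : Zplus L h → Z L h :=
  Quotient.map (naturalU L h) (by
    rintro _ u ⟨γ, rfl⟩
    exact ⟨(GammaPlus.toGamma L γ.1, GammaPlus.toGamma L γ.2), (naturalU_smul L h γ u).symm⟩)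

end Groupoids

/-! ### The symplectic space of a family of CM types -/

section CM

set_option linter.unusedSectionVars false

open ComplexEmbedding

/-- A CM type on a field `K`: a set `Φ` of complex embeddings with `Φ ∪ ιΦ = Hom(K, ℂ)` and
`Φ ∩ ιΦ = ∅`, where `ι` is complex conjugation. -/
structure CMType (K : Type*) [Field K] where
  carrier : Set (K →+* ℂ)
  union_conj : carrier ∪ conjugate '' carrier = Set.univ
  inter_conj : carrier ∩ conjugate '' carrier = ∅

variable {K : Type*} [Field K] [NumberField K]

/-- The natural map `ℝ ⊗ K → ∏_{φ ∈ Φ} ℂ`, `r ⊗ x ↦ (r φ(x))_φ`. -/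
def CMType.toProd (Φ : CMType K) : ℝ ⊗[ℚ] K →ₐ[ℝ] (Φ.carrier → ℂ) :=
  Algebra.TensorProduct.lift (Algebra.ofId ℝ (Φ.carrier → ℂ))
    (AlgHom.pi (fun φ : Φ.carrier => RingHom.toRatAlgHom φ.1))
    (fun _ _ => Commute.all _ _)

lemma CMType.toProd_tmul (Φ : CMType K) (r : ℝ) (x : K) (φ : Φ.carrier) :
    Φ.toProd (r ⊗ₜ x) φ = r * φ.1 x := by
  simp [CMType.toProd, Algebra.ofId_apply]

lemma CMType.two_mul_card (Φ : CMType K) :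
    2 * Nat.card Φ.carrier = Module.finrank ℚ K := by
  have hinj : Function.Injective (conjugate : (K →+* ℂ) → (K →+* ℂ)) :=
    fun a b hab => by simpa using congrArg conjugate hab
  have h1 := Set.ncard_union_eq (Set.disjoint_iff_inter_eq_empty.2 Φ.inter_conj)
    (Set.toFinite _) (Set.toFinite _)
  rw [Φ.union_conj, Set.ncard_univ, Set.ncard_image_of_injective _ hinj,
    Nat.card_eq_fintype_card, Embeddings.card] at h1
  rw [Nat.card_coe_set_eq]
  omega

lemma CMType.toProd_injective (Φ : CMType K) : Function.Injective Φ.toProd := by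
  rw [injective_iff_map_eq_zero]
  intro t ht
  let b := Algebra.TensorProduct.basis ℝ (integralBasis K)
  have hb : ∀ j, b j = (1 : ℝ) ⊗ₜ[ℚ] integralBasis K j :=
    fun j => Algebra.TensorProduct.basis_apply _ _
  have hΦ : ∀ φ ∈ Φ.carrier, ∑ j, (b.repr t j : ℂ) * φ (integralBasis K j) = 0 := by
    intro φ hφ
    have h1 := congrFun ht ⟨φ, hφ⟩
    rw [← b.sum_repr t, map_sum, Finset.sum_apply] at h1
    rw [← h1.trans (Pi.zero_apply _)]
    refine Finset.sum_congr rfl fun j _ => ?_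
    rw [map_smul, Pi.smul_apply, hb, CMType.toProd_tmul]
    simp
  have hall : ∀ φ : K →+* ℂ, ∑ j, (b.repr t j : ℂ) * φ (integralBasis K j) = 0 := by
    intro φ
    have hmem : φ ∈ Φ.carrier ∪ conjugate '' Φ.carrier := by
      rw [Φ.union_conj]; trivial
    rcases hmem with hφ | ⟨φ', hφ', rfl⟩
    · exact hΦ φ hφ
    · have h1 := congrArg (starRingEnd ℂ) (hΦ φ' hφ')
      rw [map_sum, map_zero] at h1
      rw [← h1]
      refine Finset.sum_congr rfl fun j _ => ?_
      rw [map_mul, Complex.conj_ofReal, conjugate_coe_eq]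
  have hlin : ∑ j, (b.repr t j : ℂ) • canonicalEmbedding.latticeBasis K j = 0 := by
    funext φ
    rw [Finset.sum_apply, Pi.zero_apply, ← hall φ]
    refine Finset.sum_congr rfl fun j _ => ?_
    rw [Pi.smul_apply, canonicalEmbedding.latticeBasis_apply, canonicalEmbedding.apply_at,
      smul_eq_mul]
  have hzero := Fintype.linearIndependent_iff.1
    (canonicalEmbedding.latticeBasis K).linearIndependent _ hlin
  apply b.repr.injective
  ext j
  simpa using hzero j

lemma CMType.toProd_bijective (Φ : CMType K) : Function.Bijective Φ.toProd := by
  classical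
  have hfin : Module.finrank ℝ (ℝ ⊗[ℚ] K) = Module.finrank ℝ (Φ.carrier → ℂ) := by
    have : Fintype Φ.carrier := Fintype.ofFinite _
    rw [Module.finrank_baseChange, Module.finrank_pi_fintype, ← Φ.two_mul_card]
    simp [mul_comm]
  have hs := (LinearMap.injective_iff_surjective_of_finrank_eq_finrank hfin
    (f := Φ.toProd.toLinearMap)).1 Φ.toProd_injective
  exact ⟨Φ.toProd_injective, hs⟩

/-- The isomorphism `ℝ ⊗ K ≅ ∏_{φ ∈ Φ} ℂ` of a CM type. -/
def CMType.equiv (Φ : CMType K) : ℝ ⊗[ℚ] K ≃ₐ[ℝ] (Φ.carrier → ℂ) :=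
  AlgEquiv.ofBijective Φ.toProd Φ.toProd_bijective

/-- The morphism `h_Φ : z ↦ (z)_{φ ∈ Φ}` with values in `ℝ ⊗ K ≅ ∏_{φ ∈ Φ} ℂ`, defined on all
of `ℂ`. -/
def CMType.h (Φ : CMType K) : ℂ →ₐ[ℝ] ℝ ⊗[ℚ] K :=
  (Φ.equiv.symm : (Φ.carrier → ℂ) →ₐ[ℝ] ℝ ⊗[ℚ] K).comp (Pi.constAlgHom ℝ Φ.carrier ℂ)

variable {ι : Type*} [Fintype ι] {E : ι → Type*} [∀ i, Field (E i)] [∀ i, NumberField (E i)]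

section Form

variable [∀ i, IsCMField (E i)]

/-- The form `ψ(x, y) = ∑ i, Tr_{E i / ℚ} (ξ i * x i * conj (y i))` on `V = ⨁ i, E i`. -/
def psi (ξ : ∀ i, E i) : LinearMap.BilinForm ℚ (∀ i, E i) :=
  LinearMap.mk₂ ℚ
    (fun x y => ∑ i, Algebra.trace ℚ (E i) (ξ i * x i * IsCMField.complexConj (E i) (y i)))
    (fun x x' y => by simp [mul_add, add_mul, Finset.sum_add_distrib])
    (fun c x y => by
      rw [Finset.smul_sum]
      refine Finset.sum_congr rfl fun i _ => ?_
      rw [Pi.smul_apply, mul_smul_comm, smul_mul_assoc, map_smul])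
    (fun x y y' => by simp [mul_add, Finset.sum_add_distrib])
    (fun c x y => by
      rw [Finset.smul_sum]
      refine Finset.sum_congr rfl fun i _ => ?_
      rw [Pi.smul_apply, map_rat_smul, mul_smul_comm, map_smul])

end Form

/-- The lattice `L = ⨁ i, 𝓞 (E i)` in `V = ⨁ i, E i`. -/
def latticeO (E : ι → Type*) [∀ i, Field (E i)] : AddSubgroup (∀ i, E i) :=
  AddSubgroup.pi Set.univ fun i => (algebraMap (𝓞 (E i)) (E i)).range.toAddSubgroup

variable [DecidableEq ι]

/-- `z ↦ (h_{Φ i}(z))_i` with values in `∏ i, ℝ ⊗ E i ≅ ℝ ⊗ V`. -/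
def hAlg (Φ : ∀ i, CMType (E i)) : ℂ →ₐ[ℝ] ℝ ⊗[ℚ] (∀ i, E i) :=
  ((Algebra.TensorProduct.piRight ℚ ℝ ℝ E).symm :
    (∀ i, ℝ ⊗[ℚ] E i) →ₐ[ℝ] ℝ ⊗[ℚ] (∀ i, E i)).comp
    (AlgHom.pi fun i => (Φ i).h)

variable [∀ i, IsCMField (E i)]

/-- Complex conjugation on `∏ i, E i`. -/
def conjV (E : ι → Type*) [∀ i, Field (E i)] [∀ i, NumberField (E i)] [∀ i, IsCMField (E i)] :
    (∀ i, E i) →ₐ[ℚ] (∀ i, E i) :=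
  AlgHom.pi fun i =>
    (RingHom.toRatAlgHom ((IsCMField.complexConj (E i) : E i →+* E i))).comp
      (Pi.evalAlgHom ℚ E i)

/-- Complex conjugation on `ℝ ⊗ ∏ i, E i`. -/
def conjR (E : ι → Type*) [∀ i, Field (E i)] [∀ i, NumberField (E i)] [∀ i, IsCMField (E i)] :
    ℝ ⊗[ℚ] (∀ i, E i) →ₐ[ℝ] ℝ ⊗[ℚ] (∀ i, E i) :=
  Algebra.TensorProduct.map (AlgHom.id ℝ ℝ) (conjV E)

lemma psi_baseChange_mul (ξ : ∀ i, E i) (a x y : ℝ ⊗[ℚ] (∀ i, E i)) :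
    (psi ξ).baseChange ℝ (a * x) y = (psi ξ).baseChange ℝ x (conjR E a * y) := by
  induction a using TensorProduct.induction_on with
  | zero => simp
  | add a b ha hb => simp only [add_mul, map_add, LinearMap.add_apply, ha, hb]
  | tmul r a =>
    induction x using TensorProduct.induction_on with
    | zero => simp
    | add x₁ x₂ h₁ h₂ => simp only [mul_add, map_add, LinearMap.add_apply, h₁, h₂]
    | tmul s x =>
      induction y using TensorProduct.induction_on with
      | zero => simp
      | add y₁ y₂ h₁ h₂ => simp only [mul_add, map_add, h₁, h₂]
      | tmul t y =>
        have e : conjR E (r ⊗ₜ[ℚ] a) = r ⊗ₜ[ℚ] conjV E a := by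
          simp [conjR]
        rw [e, Algebra.TensorProduct.tmul_mul_tmul, Algebra.TensorProduct.tmul_mul_tmul,
          LinearMap.BilinForm.baseChange_tmul, LinearMap.BilinForm.baseChange_tmul]
        have e' : psi ξ (a * x) y = psi ξ x (conjV E a * y) := by
          simp only [psi, LinearMap.mk₂_apply]
          refine Finset.sum_congr rfl fun i _ => ?_
          have : IsCMField.complexConj (E i) ((conjV E a * y) i) =
              a i * IsCMField.complexConj (E i) (y i) := by
            rw [Pi.mul_apply, map_mul]
            congr 1
            exact IsCMField.complexConj_apply_apply (E i) (a i)
          rw [this, Pi.mul_apply]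
          congr 1
          ring
        rw [e']
        congr 1
        ring

lemma toProd_conj (Φ : ∀ i, CMType (E i)) (t : ℝ ⊗[ℚ] (∀ i, E i)) (i : ι)
    (φ : (Φ i).carrier) :
    (Φ i).toProd (Algebra.TensorProduct.piRight ℚ ℝ ℝ E (conjR E t) i) φ =
      starRingEnd ℂ ((Φ i).toProd (Algebra.TensorProduct.piRight ℚ ℝ ℝ E t i) φ) := by
  induction t using TensorProduct.induction_on with
  | zero => simp
  | add a b ha hb => simp only [map_add, Pi.add_apply, ha, hb]
  | tmul r a =>
    have e : conjR E (r ⊗ₜ[ℚ] a) = r ⊗ₜ[ℚ] conjV E a := by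
      simp [conjR]
    rw [e, Algebra.TensorProduct.piRight_tmul, Algebra.TensorProduct.piRight_tmul,
      CMType.toProd_tmul, CMType.toProd_tmul, map_mul, Complex.conj_ofReal]
    congr 1
    exact IsCMField.complexEmbedding_complexConj (E i) φ.1 (a i)

lemma toProd_hAlg (Φ : ∀ i, CMType (E i)) (z : ℂ) (i : ι) (φ : (Φ i).carrier) :
    (Φ i).toProd (Algebra.TensorProduct.piRight ℚ ℝ ℝ E (hAlg Φ z) i) φ = z := by
  have e : Algebra.TensorProduct.piRight ℚ ℝ ℝ E (hAlg Φ z) = fun i => (Φ i).h z :=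
    (Algebra.TensorProduct.piRight ℚ ℝ ℝ E).apply_symm_apply _
  rw [e]
  exact congrFun ((Φ i).equiv.apply_symm_apply (fun _ => z)) φ

lemma conjR_hAlg (Φ : ∀ i, CMType (E i)) (z : ℂ) :
    conjR E (hAlg Φ z) * hAlg Φ z =
    Complex.normSq z • (1 : ℝ ⊗[ℚ] (∀ i, E i)) := by
  apply (Algebra.TensorProduct.piRight ℚ ℝ ℝ E).injective
  funext i
  apply (Φ i).toProd_injective
  funext φ
  rw [map_mul, Pi.mul_apply, map_mul, Pi.mul_apply, toProd_conj, toProd_hAlg,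
    map_smul, map_one, Pi.smul_apply, Pi.one_apply, map_smul, map_one, Pi.smul_apply, Pi.one_apply,
    ← Complex.normSq_eq_conj_mul_self]
  simp

lemma hAlg_mem_GSp (Φ : ∀ i, CMType (E i)) (ξ : ∀ i, E i) (z : ℂˣ) :
    Units.map (((Algebra.lmul ℝ (ℝ ⊗[ℚ] (∀ i, E i))).comp (hAlg Φ) :
      ℂ →ₐ[ℝ] Module.End ℝ (ℝ ⊗[ℚ] (∀ i, E i))) : ℂ →* Module.End ℝ (ℝ ⊗[ℚ] (∀ i, E i))) z ∈
      GSp ((psi ξ).baseChange ℝ) := by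
  refine ⟨Units.mk0 (Complex.normSq z) (by simp), fun x y => ?_⟩
  change (psi ξ).baseChange ℝ (hAlg Φ z * x) (hAlg Φ z * y) =
    Complex.normSq z * (psi ξ).baseChange ℝ x y
  rw [psi_baseChange_mul, ← mul_assoc, conjR_hAlg, smul_mul_assoc, one_mul, map_smul, smul_eq_mul]

/-- The morphism `h_cm : ℂˣ → GSp(ℝ)`: `z` acts on `ℝ ⊗ V = ∏ i, ℝ ⊗ E i` by multiplication by
`h_{Φ i}(z)` on the `i`-th factor. -/
def hcm (Φ : ∀ i, CMType (E i)) (ξ : ∀ i, E i) : ℂˣ →* GR (psi ξ) :=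
  (Units.map (((Algebra.lmul ℝ (ℝ ⊗[ℚ] (∀ i, E i))).comp (hAlg Φ) :
      ℂ →ₐ[ℝ] Module.End ℝ (ℝ ⊗[ℚ] (∀ i, E i))) :
        ℂ →* Module.End ℝ (ℝ ⊗[ℚ] (∀ i, E i)))).codRestrict
    (GSp ((psi ξ).baseChange ℝ)) (hAlg_mem_GSp Φ ξ)

end CM

end ShimuraBCM

end

/-! Claim 1 says that the stabilizer of a lattice has class number one, and it rests on the
elementary divisor theorem for alternating forms over ℤ. Let `g` be an adelic similitude. By
`exists_rat_mul_unit` its multiplier is a rational number `q` times a unit of ℤ̂. The rational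
vectors in g(L ⊗ ℤ̂) form a lattice L', and L' ⊗ ℤ̂ = g(L ⊗ ℤ̂). For a suitable rational c the forms
cψ on L and (c/q)ψ on L' are integral, and `g` identifies them over ℤ̂ up to a unit. A nondegenerate
alternating form over ℤ is a sum of scaled hyperbolic planes and is determined by the indices of its
radicals modulo all N (`exists_isometry_of_index_radMod_eq`). These indices can be computed in L ⊗
ℤ̂ (`radMod_index_eq_relIndex`), so they agree. An isometry L ≅ L' is then a rational similitude T
with multiplier `q` and T(L ⊗ ℤ̂) = g(L ⊗ ℤ̂), whence T⁻¹g ∈ Γ.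

Claim 2: negating one vector of each hyperbolic pair gives a rational similitude `s` of L with
multiplier -1. The identity component of GSp(ℝ) consists of the similitudes with positive
multiplier, because isometries are products of transvections and these lie on paths through 1. So
`s` exchanges the two classes modulo that component.

Claim 3: the condition on the signs of Im φ(ξ) makes ψ(x, h(i)x) definite. An element of GSp(ℝ) that
centralizes h_cm therefore has positive multiplier, X⁺ is one open orbit of the identity component,
and a rational element that moves a point of X⁺ into X⁺ lies in GSp(ℚ)⁺. This gives injectivity.
Claim 1 and the element `s` move every point of U into the image of U⁺, which gives surjectivity.
The map is open because Γ and X⁺ are open. -/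

namespace ShimuraBCM

/-! ### Alternating forms on free abelian groups -/

section IntForm

/-- A nondegenerate alternating form on a nonzero abelian group splits off a hyperbolic plane scaled
by the greatest common divisor of the values of the form. -/
theorem exists_hyperbolic_splitting {M : Type*} [AddCommGroup M] [Nontrivial M]
    (B : LinearMap.BilinForm ℤ M) (hB : B.IsAlt) (hn : ∀ x, (∀ y, B x y = 0) → x = 0) :
    ∃ (d : ℕ) (P : Submodule ℤ M) (φ : ((ℤ × ℤ) × P) ≃ₗ[ℤ] M), d ≠ 0 ∧ (∀ x y, (d : ℤ) ∣ B x y) ∧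
      (∀ u v, B (φ u) (φ v) = d * (u.1.1 * v.1.2 - u.1.2 * v.1.1) + B u.2 v.2) ∧
      ∀ x : P, (∀ y : P, B x y = 0) → x = 0 := by
  classical
  have hskew : ∀ x y, B y x = -B x y := fun x y => (hB.neg_eq x y).symm
  have hex : ∃ d : ℕ, 0 < d ∧ ∃ e f, B e f = d := by
    obtain ⟨x, hx⟩ := exists_ne (0 : M)
    obtain ⟨y, hy⟩ : ∃ y, B x y ≠ 0 := by
      by_contra! h
      exact hx (hn x h)
    rcases lt_or_gt_of_ne hy with h | h
    · exact ⟨(B y x).toNat, by rw [hskew x y]; omega, y, x, by rw [hskew x y]; omega⟩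
    · exact ⟨(B x y).toNat, by omega, x, y, by omega⟩
  obtain ⟨hd0, e, f, hef⟩ := Nat.find_spec hex
  -- The scale `d` is the least positive value of the form. Division with remainder and minimality
  -- will show that it divides every value.
  set d := Nat.find hex with hd
  have hmin : ∀ x y, 0 < B x y → (d : ℤ) ≤ B x y := fun x y h => by
    have := Nat.find_min' hex (m := (B x y).toNat) ⟨by omega, x, y, by omega⟩
    omega
  have hdz : (0 : ℤ) < d := by exact_mod_cast hd0
  have hrem : ∀ x y (n : ℤ), B x y = n % d → (d : ℤ) ∣ n := fun x y n h => by
    have h1 := Int.emod_nonneg n hdz.ne'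
    have h2 := Int.emod_lt_of_pos n hdz
    rcases h1.eq_or_lt with h0 | h0
    · exact Int.dvd_of_emod_eq_zero h0.symm
    · have := hmin x y (h ▸ h0)
      omega
  have h1 : ∀ y, (d : ℤ) ∣ B e y := fun y => hrem e (y - (B e y / d) • f) _ (by
    rw [map_sub, map_smul, hef, smul_eq_mul, Int.emod_def, mul_comm])
  have h2 : ∀ x, (d : ℤ) ∣ B x f := fun x => hrem (x - (B x f / d) • e) f _ (by
    rw [map_sub, map_smul, LinearMap.sub_apply, LinearMap.smul_apply, hef, smul_eq_mul,
      Int.emod_def, mul_comm])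
  have h3 : ∀ x y, (d : ℤ) ∣ B x y := fun x y => by
    obtain ⟨a, ha⟩ := h2 x
    obtain ⟨b, hb⟩ := h1 y
    have h4 : (d : ℤ) ∣ B x y - d * (a * b) := by
      -- Here x - a•e is orthogonal to f and y - b•f is orthogonal to e. Adding e restores the
      -- pairing `d` with f, so that subtracting a multiple of f on the right reduces the value
      -- modulo `d`.
      refine hrem (e + (x - a • e)) ((y - b • f) - ((B x y - d * (a * b)) / d) • f) _ ?_
      simp only [map_add, map_sub, map_smul, LinearMap.add_apply, LinearMap.sub_apply,
        LinearMap.smul_apply, hef, ha, hb, smul_eq_mul]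
      rw [Int.emod_def]
      ring
    simpa using h4.add (Dvd.intro _ rfl : (d : ℤ) ∣ d * (a * b))
  let P : Submodule ℤ M := LinearMap.ker (B.flip e) ⊓ LinearMap.ker (B.flip f)
  have hPe : ∀ p : P, B p e = 0 := fun p => p.2.1
  have hPf : ∀ p : P, B p f = 0 := fun p => p.2.2
  have hPe' : ∀ p : P, B e p = 0 := fun p => by rw [hskew, hPe, neg_zero]
  have hPf' : ∀ p : P, B f p = 0 := fun p => by rw [hskew, hPf, neg_zero]
  let φ : ((ℤ × ℤ) × P) →ₗ[ℤ] M :=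
    ((LinearMap.toSpanSingleton ℤ M e).coprod (LinearMap.toSpanSingleton ℤ M f)).coprod P.subtype
  have hφ : ∀ u, φ u = u.1.1 • e + u.1.2 • f + (u.2 : M) := fun u => rfl
  have hfe : B f e = -d := by rw [hskew, hef]
  have hform : ∀ u v, B (φ u) (φ v) = d * (u.1.1 * v.1.2 - u.1.2 * v.1.1) + B u.2 v.2 := by
    intro u v
    simp only [hφ, map_add, map_smul, LinearMap.add_apply, LinearMap.smul_apply, hef, hfe,
      hB.self_eq_zero, hPe, hPf, hPe', hPf', smul_eq_mul]
    ring
  have hinj : Function.Injective φ := by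
    rw [injective_iff_map_eq_zero]
    intro u hu
    have ha : B (φ u) f = u.1.1 * d := by
      simp [hφ, hef, hB.self_eq_zero, hPf]
    have hb : B (φ u) e = -(u.1.2 * d) := by
      simp [hφ, hfe, hB.self_eq_zero, hPe]
    rw [hu, map_zero, LinearMap.zero_apply, eq_comm] at ha hb
    have ha' : u.1.1 = 0 := by simpa [hd0.ne'] using ha
    have hb' : u.1.2 = 0 := by simpa [hd0.ne'] using hb
    have hp : (u.2 : M) = 0 := by simpa [hφ, ha', hb'] using hu
    exact Prod.ext (Prod.ext ha' hb') (Subtype.ext hp)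
  have hsurj : Function.Surjective φ := by
    intro x
    obtain ⟨a, ha⟩ := h3 x f
    obtain ⟨b, hb⟩ := h3 x e
    -- Since `d` divides all values, the orthogonal projection to the plane of e and f has the
    -- integral coefficients B(x,f)/d and -B(x,e)/d.
    refine ⟨((a, -b), ⟨x - a • e + b • f, ?_, ?_⟩), ?_⟩
    · simp [hb, hB.self_eq_zero, hfe, mul_comm]
    · simp [ha, hB.self_eq_zero, hef, mul_comm]
    · simp only [hφ, neg_smul]
      abel
  refine ⟨d, P, LinearEquiv.ofBijective φ ⟨hinj, hsurj⟩, hd0.ne', h3, hform, fun x hx => ?_⟩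
  refine Subtype.ext (hn x fun y => ?_)
  obtain ⟨v, rfl⟩ := hsurj y
  have := hform ((0, 0), x) v
  simpa [hφ, hx] using this

/-- The vectors that pair with everything into `N ℤ`. -/
def radMod {M : Type*} [AddCommGroup M] (B : LinearMap.BilinForm ℤ M) (N : ℕ) : AddSubgroup M where
  carrier := {x | ∀ y, (N : ℤ) ∣ B x y}
  zero_mem' y := by simp
  add_mem' ha hb y := by
    rw [map_add, LinearMap.add_apply]
    exact dvd_add (ha y) (hb y)
  neg_mem' ha y := by
    rw [map_neg, LinearMap.neg_apply]
    exact (ha y).neg_right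

lemma mem_radMod {M : Type*} [AddCommGroup M] {B : LinearMap.BilinForm ℤ M} {N : ℕ} {x : M} :
    x ∈ radMod B N ↔ ∀ y, (N : ℤ) ∣ B x y := Iff.rfl

lemma radMod_index_eq_one_iff {M : Type*} [AddCommGroup M] (B : LinearMap.BilinForm ℤ M) (N : ℕ) :
    (radMod B N).index = 1 ↔ ∀ x y, (N : ℤ) ∣ B x y := by
  rw [AddSubgroup.index_eq_one, AddSubgroup.eq_top_iff']
  rfl

/-- The integers `a` with `N ∣ d a`. -/
def radInt (d N : ℕ) : AddSubgroup ℤ where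
  carrier := {a | (N : ℤ) ∣ d * a}
  zero_mem' := by simp
  add_mem' ha hb := by
    change (N : ℤ) ∣ d * (_ + _)
    rw [mul_add]
    exact dvd_add ha hb
  neg_mem' ha := by
    change (N : ℤ) ∣ d * (-_)
    rw [mul_neg]
    exact ha.neg_right

lemma radInt_index_ne_zero (d : ℕ) {N : ℕ} (hN : N ≠ 0) : (radInt d N).index ≠ 0 := by
  have hle : AddSubgroup.zmultiples (N : ℤ) ≤ radInt d N := by
    rw [AddSubgroup.zmultiples_le]
    exact Dvd.intro_left _ rfl
  have h := AddSubgroup.index_dvd_of_le hle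
  rw [Int.index_zmultiples, Int.natAbs_natCast] at h
  exact fun h0 => hN (by simpa [h0] using h)

/-- A vector of the plane scaled by `d` pairs into Nℤ exactly when both coordinates lie in `radInt d
N`. The radical is thus a product, and the two coordinates contribute equal factors to the index. -/
lemma radMod_index_of_splitting {M P : Type*} [AddCommGroup M] [AddCommGroup P]
    {B : LinearMap.BilinForm ℤ M} {C : LinearMap.BilinForm ℤ P} {d : ℕ}
    (φ : ((ℤ × ℤ) × P) ≃ₗ[ℤ] M)
    (hφ : ∀ u v, B (φ u) (φ v) = d * (u.1.1 * v.1.2 - u.1.2 * v.1.1) + C u.2 v.2) (N : ℕ) :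
    (radMod B N).index = (radInt d N).index ^ 2 * (radMod C N).index := by
  have h : ((radInt d N).prod (radInt d N)).prod (radMod C N) =
      (radMod B N).comap (φ : ((ℤ × ℤ) × P) →+ M) := by
    ext u
    simp only [AddSubgroup.mem_prod, AddSubgroup.mem_comap, mem_radMod]
    constructor
    · rintro ⟨⟨h1, h2⟩, h3⟩ y
      obtain ⟨v, rfl⟩ := φ.surjective y
      change (N : ℤ) ∣ B (φ u) (φ v)
      rw [hφ, show (d : ℤ) * (u.1.1 * v.1.2 - u.1.2 * v.1.1) =
        d * u.1.1 * v.1.2 - d * u.1.2 * v.1.1 by ring]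
      exact dvd_add (dvd_sub (h1.mul_right _) (h2.mul_right _)) (h3 _)
    · intro h
      have h' : ∀ v : (ℤ × ℤ) × P, (N : ℤ) ∣ d * (u.1.1 * v.1.2 - u.1.2 * v.1.1) + C u.2 v.2 := fun v =>
        hφ u v ▸ h (φ v)
      refine ⟨⟨?_, ?_⟩, fun p => by simpa using h' ((0, 0), p)⟩
      · change (N : ℤ) ∣ d * u.1.1
        simpa using h' ((0, 1), 0)
      · change (N : ℤ) ∣ d * u.1.2
        simpa using h' ((1, 0), 0)
  rw [← AddSubgroup.index_comap_of_surjective (radMod B N)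
    (f := (φ : ((ℤ × ℤ) × P) →+ M)) φ.surjective, ← h, AddSubgroup.index_prod,
    AddSubgroup.index_prod, sq]

/-- A nondegenerate alternating form over `ℤ` has an automorphism with multiplier `-1`. -/
theorem exists_antiIsometry (n : ℕ) {M : Type*} [AddCommGroup M] [Module.Finite ℤ M]
    [Module.Free ℤ M] (hM : Module.finrank ℤ M = n) (B : LinearMap.BilinForm ℤ M) (hB : B.IsAlt)
    (hn : ∀ x, (∀ y, B x y = 0) → x = 0) :
    ∃ s : M ≃ₗ[ℤ] M, ∀ x y, B (s x) (s y) = -B x y := by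
  induction n using Nat.strong_induction_on generalizing M with
  | _ n ih =>
  rcases subsingleton_or_nontrivial M with h | h
  · exact ⟨LinearEquiv.refl ℤ M, fun x y => by simp [Subsingleton.elim x 0]⟩
  obtain ⟨d, P, φ, -, -, hφ, hP⟩ := exists_hyperbolic_splitting B hB hn
  have hrk := φ.finrank_eq
  rw [Module.finrank_prod, Module.finrank_prod, Module.finrank_self] at hrk
  obtain ⟨s, hs⟩ := ih (Module.finrank ℤ P) (by omega) rfl (B.restrict P)
    (fun x => hB.self_eq_zero x) hP
  -- On the plane, negating the second coordinate changes the sign of the form; on the complement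
  -- the induction hypothesis applies.
  refine ⟨φ.symm.trans ((((LinearEquiv.refl ℤ ℤ).prodCongr (LinearEquiv.neg ℤ)).prodCongr s).trans
    φ), fun x y => ?_⟩
  obtain ⟨u, rfl⟩ := φ.surjective x
  obtain ⟨v, rfl⟩ := φ.surjective y
  have := hs u.2 v.2
  simp only [LinearMap.BilinForm.restrict_apply, LinearMap.domRestrict_apply] at this
  simp only [LinearEquiv.trans_apply, LinearEquiv.symm_apply_apply, hφ,
    LinearEquiv.prodCongr_apply, LinearEquiv.refl_apply, LinearEquiv.neg_apply, this]
  ring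

/-- Nondegenerate alternating forms over `ℤ` of the same rank are classified by the indices of
their radicals modulo all positive integers. -/
theorem exists_isometry_of_index_radMod_eq (n : ℕ) {M M' : Type*}
    [AddCommGroup M] [Module.Finite ℤ M] [Module.Free ℤ M]
    [AddCommGroup M'] [Module.Finite ℤ M'] [Module.Free ℤ M']
    (hM : Module.finrank ℤ M = n) (hM' : Module.finrank ℤ M' = n)
    (B : LinearMap.BilinForm ℤ M) (hB : B.IsAlt) (hn : ∀ x, (∀ y, B x y = 0) → x = 0)
    (B' : LinearMap.BilinForm ℤ M') (hB' : B'.IsAlt) (hn' : ∀ x, (∀ y, B' x y = 0) → x = 0)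
    (hidx : ∀ N : ℕ, N ≠ 0 → (radMod B N).index = (radMod B' N).index) :
    ∃ s : M ≃ₗ[ℤ] M', ∀ x y, B' (s x) (s y) = B x y := by
  induction n using Nat.strong_induction_on generalizing M M' with
  | _ n ih =>
  rcases Nat.eq_zero_or_pos n with rfl | hpos
  · have h := Module.finrank_zero_iff.1 hM
    have h' := Module.finrank_zero_iff.1 hM'
    exact ⟨LinearEquiv.ofSubsingleton M M', fun x y => by
      simp [Subsingleton.elim x 0]⟩
  have : Nontrivial M := Module.nontrivial_of_finrank_pos (R := ℤ) (by omega)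
  have : Nontrivial M' := Module.nontrivial_of_finrank_pos (R := ℤ) (by omega)
  obtain ⟨d, P, φ, hd, hdv, hφ, hP⟩ := exists_hyperbolic_splitting B hB hn
  obtain ⟨d', P', φ', hd', hdv', hφ', hP'⟩ := exists_hyperbolic_splitting B' hB' hn'
  -- The index at N is 1 exactly when N divides all values. The indices therefore determine `d`, the
  -- largest such N.
  have hdd : d = d' := by
    have h1 := (radMod_index_eq_one_iff B' d).1
      ((hidx d hd).symm.trans ((radMod_index_eq_one_iff B d).2 hdv))
      (φ' ((1, 0), 0)) (φ' ((0, 1), 0))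
    have h2 := (radMod_index_eq_one_iff B d').1
      ((hidx d' hd').trans ((radMod_index_eq_one_iff B' d').2 hdv'))
      (φ ((1, 0), 0)) (φ ((0, 1), 0))
    simp only [hφ, hφ', mul_one, mul_zero, sub_zero, Submodule.coe_zero, map_zero, add_zero,
      Int.natCast_dvd_natCast] at h1 h2
    exact Nat.dvd_antisymm h1 h2
  subst hdd
  have hrk := φ.finrank_eq
  have hrk' := φ'.finrank_eq
  rw [Module.finrank_prod, Module.finrank_prod, Module.finrank_self] at hrk hrk'
  obtain ⟨s, hs⟩ := ih (Module.finrank ℤ P) (by omega) rfl (by omega) (B.restrict P)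
    (fun x => hB.self_eq_zero x) hP (B'.restrict P') (fun x => hB'.self_eq_zero x) hP'
    -- Both planes have the same scale, so their common nonzero factor cancels and the complements
    -- again have equal indices.
    (fun N hN => by
      have h := hidx N hN
      rw [radMod_index_of_splitting (C := B.restrict P) φ hφ,
        radMod_index_of_splitting (C := B'.restrict P') φ' hφ'] at h
      exact Nat.eq_of_mul_eq_mul_left (pow_pos (Nat.pos_of_ne_zero (radInt_index_ne_zero d hN)) 2)
        h)
  refine ⟨φ.symm.trans (((LinearEquiv.refl ℤ (ℤ × ℤ)).prodCongr s).trans φ'), fun x y => ?_⟩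
  obtain ⟨u, rfl⟩ := φ.surjective x
  obtain ⟨v, rfl⟩ := φ.surjective y
  have := hs u.2 v.2
  simp only [LinearMap.BilinForm.restrict_apply, LinearMap.domRestrict_apply] at this
  simp only [LinearEquiv.trans_apply, LinearEquiv.symm_apply_apply, hφ, hφ',
    LinearEquiv.prodCongr_apply, LinearEquiv.refl_apply, this]

end IntForm

/-! ### Integral finite adeles of `ℚ` -/

section Adeles

open IsDedekindDomain HeightOneSpectrum

/-- The ring `ℤ̂` of finite adeles of `ℚ` that are integral at all primes. -/
def intAdele : Subring FinAdele where
  carrier := {a | ∀ p, a p ∈ p.adicCompletionIntegers ℚ}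
  mul_mem' ha hb p := mul_mem (ha p) (hb p)
  one_mem' _ := one_mem _
  add_mem' ha hb p := add_mem (ha p) (hb p)
  zero_mem' _ := zero_mem _
  neg_mem' ha p := neg_mem (ha p)

lemma isOpen_intAdele : IsOpen (intAdele : Set FinAdele) :=
  RestrictedProduct.isOpen_forall_mem
    (A := fun v : HeightOneSpectrum ℤ => (v.adicCompletionIntegers ℚ : Set (v.adicCompletion ℚ)))
    (fun _ => Valued.isOpen_valuationSubring _)

lemma algebraMap_mem_intAdele_iff {x : ℚ} :
    algebraMap ℚ FinAdele x ∈ intAdele ↔ ∃ n : ℤ, (n : ℚ) = x := by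
  have h : algebraMap ℚ FinAdele x ∈ intAdele ↔
      ∀ v : HeightOneSpectrum ℤ, v.valuation ℚ x ≤ 1 := by
    refine forall_congr' fun p => ?_
    rw [FiniteAdeleRing.algebraMap_apply, mem_adicCompletionIntegers,
      valuedAdicCompletion_eq_valuation']
  rw [h]
  constructor
  · intro hx
    obtain ⟨n, hn⟩ := mem_integers_of_valuation_le_one ℚ x hx
    exact ⟨n, by simpa using hn⟩
  · rintro ⟨n, rfl⟩ v
    exact v.valuation_le_one n

lemma intCast_mem_intAdele (n : ℤ) : algebraMap ℚ FinAdele n ∈ intAdele :=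
  algebraMap_mem_intAdele_iff.2 ⟨n, rfl⟩

lemma natCast_mem_intAdele (n : ℕ) : algebraMap ℚ FinAdele n ∈ intAdele :=
  algebraMap_mem_intAdele_iff.2 ⟨n, by simp⟩

lemma algebraMap_mul_apply (x : ℚ) (a : FinAdele) (p : HeightOneSpectrum ℤ) :
    (algebraMap ℚ FinAdele x * a) p = algebraMap ℚ (p.adicCompletion ℚ) x * a p := rfl

lemma valued_algebraMap (p : HeightOneSpectrum ℤ) (x : ℚ) :
    Valued.v (algebraMap ℚ (p.adicCompletion ℚ) x) = p.valuation ℚ x :=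
  valuedAdicCompletion_eq_valuation' p x

/-- Only finitely many components fail to be integral; N is a product of one denominator for each of
them. -/
lemma exists_natCast_mul_mem_intAdele (a : FinAdele) :
    ∃ N : ℕ, N ≠ 0 ∧ algebraMap ℚ FinAdele N * a ∈ intAdele := by
  classical
  have hfin : {p : HeightOneSpectrum ℤ | a p ∉ p.adicCompletionIntegers ℚ}.Finite := a.2
  have hint : ∀ (p : HeightOneSpectrum ℤ) (n : ℤ),
      algebraMap ℚ (p.adicCompletion ℚ) n ∈ p.adicCompletionIntegers ℚ := fun p n =>
    intCast_mem_intAdele n p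
  have hloc : ∀ p : HeightOneSpectrum ℤ, ∃ b : ℕ, b ≠ 0 ∧
      algebraMap ℚ (p.adicCompletion ℚ) b * a p ∈ p.adicCompletionIntegers ℚ := fun p => by
    obtain ⟨b, hb, h⟩ := adicCompletion.mul_nonZeroDivisor_mem_adicCompletionIntegers p (a p)
    refine ⟨b.natAbs, by simpa using nonZeroDivisors.ne_zero hb, ?_⟩
    have hab : (b.natAbs : ℚ) = (b.sign : ℤ) * (b : ℤ) := by
      rw [← Int.cast_mul, Int.sign_mul_self_eq_abs, Int.abs_eq_natAbs, Int.cast_natCast]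
    rw [hab, map_mul, mul_assoc]
    refine mul_mem (hint p _) ?_
    rw [mul_comm]
    exact h
  choose b hb hab using hloc
  refine ⟨∏ p ∈ hfin.toFinset, b p, Finset.prod_ne_zero_iff.2 fun p _ => hb p, fun p => ?_⟩
  rw [algebraMap_mul_apply]
  by_cases hp : a p ∈ p.adicCompletionIntegers ℚ
  · exact mul_mem (by simpa using hint p (∏ p ∈ hfin.toFinset, b p : ℕ)) hp
  · rw [← Finset.prod_erase_mul _ _ (hfin.mem_toFinset.2 hp : p ∈ hfin.toFinset), Nat.cast_mul,
      map_mul, mul_assoc]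
    exact mul_mem (by simpa using hint p (∏ p ∈ hfin.toFinset.erase p, b p : ℕ)) (hab p)

/-- This is the density of ℤ in ℤ̂. Each component is approximated by a rational number and then by
an integer, and the Chinese remainder theorem glues the integers at the primes dividing N. At the
other primes N is a unit and there is no condition. -/
lemma exists_int_approx (a : FinAdele) (ha : a ∈ intAdele) {N : ℕ} (hN : N ≠ 0) :
    ∃ n : ℤ, ∃ c ∈ intAdele, a = algebraMap ℚ FinAdele n + algebraMap ℚ FinAdele N * c := by
  classical
  have hNz : (N : ℤ) ≠ 0 := by exact_mod_cast hN
  have hNq : (N : ℚ) ≠ 0 := by exact_mod_cast hN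
  have hv0 : ∀ p : HeightOneSpectrum ℤ, p.valuation ℚ (N : ℚ) ≠ 0 := fun p => by
    rwa [Valuation.ne_zero_iff]
  have hv1 : ∀ (p : HeightOneSpectrum ℤ) (n : ℤ), p.valuation ℚ (n : ℚ) ≤ 1 := fun p n =>
    p.valuation_le_one n
  -- The support of N⁻¹ is the set of primes dividing N.
  have hfin := Support.finite (R := ℤ) ((N : ℚ)⁻¹)
  have hloc : ∀ p : HeightOneSpectrum ℤ, ∃ n : ℤ,
      Valued.v (a p - algebraMap ℚ (p.adicCompletion ℚ) n) ≤ p.valuation ℚ (N : ℚ) := by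
    intro p
    obtain ⟨k, hk⟩ : ∃ k : ℚ,
        Valued.v (a p - algebraMap ℚ (p.adicCompletion ℚ) k) ≤ p.valuation ℚ (N : ℚ) := by
      have hcont : Continuous fun x : p.adicCompletion ℚ =>
          algebraMap ℚ (p.adicCompletion ℚ) ((N : ℚ)⁻¹) * (a p - x) := by fun_prop
      obtain ⟨k, hk⟩ := (denseRange_algebraMap (K := ℚ) p).exists_mem_open
        ((Valued.isOpen_valuationSubring (p.adicCompletion ℚ)).preimage hcont)
        ⟨a p, by simp⟩
      refine ⟨k, ?_⟩
      have hk' : Valued.v (algebraMap ℚ (p.adicCompletion ℚ) ((N : ℚ)⁻¹) *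
        (a p - algebraMap ℚ (p.adicCompletion ℚ) k)) ≤ 1 := hk
      rwa [map_mul, valued_algebraMap, map_inv₀, inv_mul_le_one₀ (zero_lt_iff.2 (hv0 p))] at hk'
    have hk1 : p.valuation ℚ k ≤ 1 := by
      rw [← valued_algebraMap, ← sub_sub_self (a p) (algebraMap ℚ (p.adicCompletion ℚ) k)]
      exact (Valuation.map_sub _ _ _).trans (max_le (ha p) (hk.trans (hv1 p N)))
    obtain ⟨n, hn⟩ := exists_valuation_sub_lt_of_integer p hk1 (Units.mk0 _ (hv0 p))
    refine ⟨n, ?_⟩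
    rw [← sub_sub_sub_cancel_right _ _ (algebraMap ℚ (p.adicCompletion ℚ) k), ← map_sub]
    refine (Valuation.map_sub _ _ _).trans (max_le hk ?_)
    rw [valued_algebraMap]
    exact hn.le
  choose m hm using hloc
  have hexp : ∀ p : HeightOneSpectrum ℤ, ∃ e : ℕ,
      p.valuation ℚ (N : ℚ) = WithZero.exp (-(e : ℤ)) := fun p => by
    have h := p.valuation_of_algebraMap (K := ℚ) (N : ℤ)
    rw [intValuation_if_neg _ hNz] at h
    exact ⟨_, h⟩
  choose e he using hexp
  obtain ⟨y, hy⟩ := IsDedekindDomain.exists_forall_sub_mem_ideal (s := hfin.toFinset)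
    (fun p : HeightOneSpectrum ℤ => p.asIdeal) e (fun p _ => p.prime)
    (fun p _ q _ hpq h => hpq (HeightOneSpectrum.ext h)) (fun p => m p)
  have hay : ∀ p, Valued.v (a p - algebraMap ℚ (p.adicCompletion ℚ) y) ≤ p.valuation ℚ (N : ℚ) := by
    intro p
    by_cases hp : p ∈ hfin.toFinset
    · rw [← sub_sub_sub_cancel_right _ _ (algebraMap ℚ (p.adicCompletion ℚ) (m p)), ← map_sub]
      refine (Valuation.map_sub _ _ _).trans (max_le (hm p) ?_)
      rw [valued_algebraMap, he, ← Int.cast_sub]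
      have h := (intValuation_le_pow_iff_mem p _ _).2 (hy p hp)
      rwa [← valuation_of_algebraMap (K := ℚ)] at h
    · have h1 : 1 ≤ p.valuation ℚ (N : ℚ) := by
        have : ¬ 1 < p.valuation ℚ ((N : ℚ)⁻¹) := fun h => hp (hfin.mem_toFinset.2 h)
        rwa [map_inv₀, not_lt, inv_le_one₀ (zero_lt_iff.2 (hv0 p))] at this
      refine le_trans ((Valuation.map_sub _ _ _).trans (max_le (ha p) ?_)) h1
      rw [valued_algebraMap]
      exact hv1 p y
  refine ⟨y, algebraMap ℚ FinAdele ((N : ℚ)⁻¹) * (a - algebraMap ℚ FinAdele y), fun p => ?_, ?_⟩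
  · rw [algebraMap_mul_apply, mem_adicCompletionIntegers, map_mul, valued_algebraMap, map_inv₀,
      inv_mul_le_one₀ (zero_lt_iff.2 (hv0 p))]
    exact hay p
  · rw [← mul_assoc, ← map_mul, mul_inv_cancel₀ hNq, map_one, one_mul, add_sub_cancel]

/-- Every finite idele of `ℚ` is the product of a rational number and a unit of `ℤ̂`. -/
lemma exists_rat_mul_unit (ν : FinAdeleˣ) :
    ∃ q : ℚ, q ≠ 0 ∧ ∃ w ∈ intAdele, ∃ w' ∈ intAdele, w * w' = 1 ∧
      (ν : FinAdele) = algebraMap ℚ FinAdele q * w := by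
  obtain ⟨N, hN, hNν⟩ := exists_natCast_mul_mem_intAdele ν
  obtain ⟨M, hM, hMν⟩ := exists_natCast_mul_mem_intAdele (ν⁻¹ : FinAdeleˣ)
  set j := algebraMap ℚ FinAdele with hj
  set a := j N * ν with ha
  -- The ideal of the integers in aℤ̂. Its generator q will satisfy aℤ̂ = qℤ̂.
  let I : Ideal ℤ := 
    { carrier := {n | ∃ w ∈ intAdele, j n = a * w}
      zero_mem' := ⟨0, zero_mem _, by simp⟩
      add_mem' := by
        rintro x y ⟨w, hw, hx⟩ ⟨z, hz, hy⟩
        exact ⟨w + z, add_mem hw hz, by rw [Int.cast_add, map_add, hx, hy, mul_add]⟩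
      smul_mem' := by
        rintro c x ⟨w, hw, hx⟩
        exact ⟨j c * w, mul_mem (intCast_mem_intAdele c) hw, by
          rw [smul_eq_mul, Int.cast_mul, map_mul, hx]; ring⟩ }
  obtain ⟨q, hq⟩ := IsPrincipalIdealRing.principal I
  have hmem : ∀ n, n ∈ I ↔ ∃ k, n = q * k := fun n => by
    rw [hq, Submodule.mem_span_singleton]
    exact exists_congr fun k => by rw [smul_eq_mul, mul_comm, eq_comm]
  have hu : (ν : FinAdele) * (ν⁻¹ : FinAdeleˣ) = 1 := ν.mul_inv
  have hMI : ((N * M : ℕ) : ℤ) ∈ I := ⟨j M * (ν⁻¹ : FinAdeleˣ), hMν, by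
    push_cast
    rw [map_mul, ha]
    linear_combination (-(j N * j M)) * hu⟩
  obtain ⟨k, hk⟩ := (hmem _).1 hMI
  obtain ⟨w, hw, hqw⟩ : q ∈ I := (hmem q).2 ⟨1, by ring⟩
  have hNM : N * M ≠ 0 := mul_ne_zero hN hM
  have hq0 : q ≠ 0 := by
    rintro rfl
    rw [zero_mul] at hk
    exact hNM (by exact_mod_cast hk)
  -- The modulus NM lies in `I`, so replacing `a` by an integer modulo NM stays inside aℤ̂ and puts
  -- `a` itself in qℤ̂.
  obtain ⟨n, c, hc, hac⟩ := exists_int_approx a hNν hNM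
  -- From NM = a · Mν⁻¹ one gets n = a - NM·c = a(1 - Mν⁻¹c).
  have hnI : n ∈ I := ⟨1 - j M * (ν⁻¹ : FinAdeleˣ) * c,
    sub_mem (one_mem _) (mul_mem hMν hc), by
      rw [mul_sub, mul_one]
      have h1 : j ((N * M : ℕ) : ℚ) = j N * j M := by rw [Nat.cast_mul, map_mul]
      rw [← hj, h1] at hac
      linear_combination -hac + (j N * j M * c) * hu + (j M * (ν⁻¹ : FinAdeleˣ) * c) * ha⟩
  obtain ⟨l, hl⟩ := (hmem _).1 hnI
  have hNj : j ((N : ℚ)⁻¹) * j N = 1 := by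
    rw [← map_mul, inv_mul_cancel₀ (by exact_mod_cast hN), map_one]
  have hqj : j ((q : ℚ)⁻¹) * j q = 1 := by
    rw [← map_mul, inv_mul_cancel₀ (by exact_mod_cast hq0), map_one]
  have haq : a = j q * (j l + j k * c) := by
    have h1 : j n = j q * j l := by rw [hl, Int.cast_mul, map_mul]
    have h2 : j ((N * M : ℕ) : ℚ) = j q * j k := by
      rw [← map_mul, ← Int.cast_mul, ← hk, Int.cast_natCast]
    rw [hac, h1, h2]
    ring
  refine ⟨(N : ℚ)⁻¹ * q, mul_ne_zero (inv_ne_zero (by exact_mod_cast hN)) (by exact_mod_cast hq0),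
    j l + j k * c, add_mem (intCast_mem_intAdele l) (mul_mem (intCast_mem_intAdele k) hc), w, hw,
    ?_, ?_⟩
  · have h3 : j q = j q * ((j l + j k * c) * w) := by
      nth_rewrite 1 [hqw]
      rw [haq]
      ring
    linear_combination (j ((q : ℚ)⁻¹)) * (-h3) + ((j l + j k * c) * w - 1) * (-hqj)
  · rw [map_mul]
    linear_combination (-(ν : FinAdele)) * hNj + j ((N : ℚ)⁻¹) * haq

end Adeles

/-! ### Lattices in rational vector spaces and their adelic completions -/

section Lattices

variable {V : Type*} [AddCommGroup V]

lemma mem_span_int_range_iff {κ : Type*} {L : AddSubgroup V} (c : Module.Basis κ ℤ L) {v : V} :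
    v ∈ Submodule.span ℤ (Set.range fun i => (c i : V)) ↔ v ∈ L := by
  have h := congrArg (Submodule.map L.subtype.toIntLinearMap) c.span_eq
  rw [Submodule.map_span, ← Set.range_comp, Submodule.map_top] at h
  change v ∈ Submodule.span ℤ (Set.range (L.subtype.toIntLinearMap ∘ c)) ↔ v ∈ L
  rw [h]
  exact ⟨fun ⟨x, hx⟩ => hx ▸ x.2, fun hv => ⟨⟨v, hv⟩, rfl⟩⟩

variable [Module ℚ V]

/-- A subgroup `L` of a rational vector space `V` is a lattice if it is finitely generated and
spans `V`. -/
structure IsLattice (L : AddSubgroup V) : Prop where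
  finite : Module.Finite ℤ L
  span_eq_top : Submodule.span ℚ (L : Set V) = ⊤

lemma IsLattice.free {L : AddSubgroup V} (hL : IsLattice L) : Module.Free ℤ L := by
  have := hL.finite
  have : IsAddTorsionFree V := IsAddTorsionFree.of_module_rat V
  have : IsAddTorsionFree L := Function.Injective.isAddTorsionFree L.subtype Subtype.val_injective
  infer_instance

lemma IsLattice.exists_basis {κ : Type*} {L : AddSubgroup V} (hL : IsLattice L)
    (c : Module.Basis κ ℤ L) : ∃ b : Module.Basis κ ℚ V, ∀ i, b i = c i := by
  have hli : LinearIndependent ℤ (fun i => (c i : V)) :=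
    c.linearIndependent.map' L.subtype.toIntLinearMap
      (LinearMap.ker_eq_bot.2 Subtype.val_injective)
  rw [LinearIndependent.iff_fractionRing ℤ ℚ] at hli
  refine ⟨Module.Basis.mk hli ?_, fun i => Module.Basis.mk_apply _ _ i⟩
  rw [← hL.span_eq_top, Submodule.span_le]
  intro x hx
  exact Submodule.span_le_restrictScalars ℤ ℚ _ ((mem_span_int_range_iff c).2 hx)

lemma IsLattice.exists_rat_basis {L : AddSubgroup V} (hL : IsLattice L) :
    ∃ (n : ℕ) (b : Module.Basis (Fin n) ℚ V), ∀ v, v ∈ L ↔ ∀ i, ∃ m : ℤ, (m : ℚ) = b.repr v i := by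
  have := hL.finite
  have := hL.free
  let c := Module.finBasis ℤ L
  obtain ⟨b, hb⟩ := hL.exists_basis c
  refine ⟨_, b, fun v => ?_⟩
  rw [← mem_span_int_range_iff c, ← funext hb, b.mem_span_iff_repr_mem ℤ v]
  simp

lemma IsLattice.finrank {L : AddSubgroup V} (hL : IsLattice L) :
    Module.finrank ℤ L = Module.finrank ℚ V := by
  have := hL.finite
  have := hL.free
  obtain ⟨b, -⟩ := hL.exists_basis (Module.finBasis ℤ L)
  rw [Module.finrank_eq_card_basis b, Fintype.card_fin]

lemma natCast_smul_adele (N : ℕ) (t : FinAdele ⊗[ℚ] V) :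
    algebraMap ℚ FinAdele N • t = N • t := by
  rw [map_natCast, Nat.cast_smul_eq_nsmul]

lemma tmul_mem_adelicLattice {L : AddSubgroup V} {a : FinAdele} (ha : a ∈ intAdele) {x : V}
    (hx : x ∈ L) : a ⊗ₜ[ℚ] x ∈ adelicLattice L :=
  AddSubgroup.subset_closure ⟨a, ha, x, hx, rfl⟩

lemma adelicLattice_induction {L : AddSubgroup V} {S : AddSubgroup (FinAdele ⊗[ℚ] V)}
    (h : ∀ a ∈ intAdele, ∀ x ∈ L, a ⊗ₜ[ℚ] x ∈ S) : adelicLattice L ≤ S := by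
  rw [adelicLattice, AddSubgroup.closure_le]
  rintro _ ⟨a, ha, x, hx, rfl⟩
  exact h a ha x hx

lemma smul_mem_adelicLattice {L : AddSubgroup V} {c : FinAdele} (hc : c ∈ intAdele)
    {t : FinAdele ⊗[ℚ] V} (ht : t ∈ adelicLattice L) : c • t ∈ adelicLattice L := by
  refine adelicLattice_induction (S := (adelicLattice L).comap
    (DistribSMul.toAddMonoidHom _ c)) (fun a ha x hx => ?_) ht
  exact tmul_mem_adelicLattice (mul_mem hc ha) hx

lemma mem_adelicLattice_iff {L : AddSubgroup V} {n : ℕ} {b : Module.Basis (Fin n) ℚ V}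
    (hb : ∀ v, v ∈ L ↔ ∀ i, ∃ m : ℤ, (m : ℚ) = b.repr v i) {t : FinAdele ⊗[ℚ] V} :
    t ∈ adelicLattice L ↔ ∀ i, (Algebra.TensorProduct.basis FinAdele b).repr t i ∈ intAdele := by
  constructor
  · intro ht i
    refine adelicLattice_induction (S := intAdele.toAddSubgroup.comap
      ((Algebra.TensorProduct.basis FinAdele b).coord i).toAddMonoidHom) (fun a ha x hx => ?_) ht
    change (Algebra.TensorProduct.basis FinAdele b).repr (a ⊗ₜ x) i ∈ intAdele
    rw [Algebra.TensorProduct.basis_repr_tmul, Finsupp.smul_apply, Finsupp.mapRange_apply,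
      smul_eq_mul]
    exact mul_mem ha (algebraMap_mem_intAdele_iff.2 ((hb x).1 hx i))
  · intro h
    rw [← (Algebra.TensorProduct.basis FinAdele b).sum_repr t]
    refine sum_mem fun i _ => smul_mem_adelicLattice (h i) ?_
    rw [Algebra.TensorProduct.basis_apply]
    exact tmul_mem_adelicLattice (one_mem _) ((hb _).2 fun k => ⟨if i = k then 1 else 0, by
      rw [b.repr_self, Finsupp.single_apply]; split_ifs <;> simp⟩)

lemma IsLattice.one_tmul_mem_iff {L : AddSubgroup V} (hL : IsLattice L) {v : V} :
    (1 : FinAdele) ⊗ₜ[ℚ] v ∈ adelicLattice L ↔ v ∈ L := by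
  obtain ⟨n, b, hb⟩ := hL.exists_rat_basis
  rw [mem_adelicLattice_iff hb, hb]
  refine forall_congr' fun i => ?_
  rw [Algebra.TensorProduct.basis_repr_tmul, Finsupp.smul_apply, Finsupp.mapRange_apply, one_smul,
    algebraMap_mem_intAdele_iff]

/-- Strong approximation for the lattice, L ⊗ ℤ̂ = L + N(L ⊗ ℤ̂), obtained coordinate by coordinate
from `exists_int_approx`. -/
lemma IsLattice.exists_approx {L : AddSubgroup V} (hL : IsLattice L) {t : FinAdele ⊗[ℚ] V}
    (ht : t ∈ adelicLattice L) {N : ℕ} (hN : N ≠ 0) :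
    ∃ v ∈ L, ∃ s ∈ adelicLattice L, t = (1 : FinAdele) ⊗ₜ[ℚ] v + N • s := by
  obtain ⟨n, b, hb⟩ := hL.exists_rat_basis
  have hint := (mem_adelicLattice_iff hb).1 ht
  choose m c hc h using fun i => exists_int_approx _ (hint i) hN
  let e := Algebra.TensorProduct.basis FinAdele b
  have hbL : ∀ i, b i ∈ L := fun i => (hb _).2 fun k => ⟨if i = k then 1 else 0, by
      rw [b.repr_self, Finsupp.single_apply]; split_ifs <;> simp⟩
  refine ⟨∑ i, m i • b i, sum_mem fun i _ => zsmul_mem (hbL i) _, ∑ i, c i • e i,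
    sum_mem fun i _ => smul_mem_adelicLattice (hc i) ?_, ?_⟩
  · rw [Algebra.TensorProduct.basis_apply]
    exact tmul_mem_adelicLattice (one_mem _) (hbL i)
  · rw [← e.sum_repr t, TensorProduct.tmul_sum, Finset.smul_sum, ← Finset.sum_add_distrib]
    refine Finset.sum_congr rfl fun i _ => ?_
    rw [h i, add_smul, mul_smul, natCast_smul_adele]
    congr 1
    rw [Algebra.TensorProduct.basis_apply, ← Int.cast_smul_eq_zsmul ℚ, TensorProduct.tmul_smul,
      algebraMap_smul]

/-- The matrix of `f` in a basis of L has finitely many entries, and N is a common denominator of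
them. -/
lemma IsLattice.exists_smul_mem {L : AddSubgroup V} (hL : IsLattice L)
    (f : Module.End FinAdele (FinAdele ⊗[ℚ] V)) :
    ∃ N : ℕ, N ≠ 0 ∧ ∀ t ∈ adelicLattice L, N • f t ∈ adelicLattice L := by
  obtain ⟨n, b, hb⟩ := hL.exists_rat_basis
  let e := Algebra.TensorProduct.basis FinAdele b
  choose N hN h using fun i j => exists_natCast_mul_mem_intAdele (e.repr (f (e i)) j)
  refine ⟨∏ i, ∏ j, N i j, by simp [Finset.prod_eq_zero_iff, hN], fun t ht => ?_⟩
  have hint := (mem_adelicLattice_iff hb).1 ht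
  rw [← e.sum_repr t, map_sum, Finset.smul_sum]
  refine sum_mem fun i _ => ?_
  rw [map_smul, smul_comm]
  refine smul_mem_adelicLattice (hint i) ?_
  rw [← natCast_smul_adele, mem_adelicLattice_iff hb]
  intro j
  rw [map_smul, Finsupp.smul_apply, smul_eq_mul]
  obtain ⟨r, hr⟩ : N i j ∣ ∏ i, ∏ j, N i j :=
    (Finset.dvd_prod_of_mem (fun j => N i j) (Finset.mem_univ j)).trans
      (Finset.dvd_prod_of_mem (fun i => ∏ j, N i j) (Finset.mem_univ i))
  rw [hr, mul_comm (N i j), Nat.cast_mul, map_mul, mul_assoc]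
  exact mul_mem (natCast_mem_intAdele r) (h i j)

/-- The lattice of all vectors of `V` that lie in `g (L ⊗ ℤ̂)`. -/
noncomputable def latticeImage (g : (Module.End FinAdele (FinAdele ⊗[ℚ] V))ˣ) (L : AddSubgroup V) :
    AddSubgroup V :=
  (adelicLattice L).comap (((g⁻¹ : (Module.End FinAdele (FinAdele ⊗[ℚ] V))ˣ) :
    Module.End FinAdele (FinAdele ⊗[ℚ] V)).toAddMonoidHom.comp
      (TensorProduct.mk ℚ FinAdele V 1).toAddMonoidHom)

variable (g : (Module.End FinAdele (FinAdele ⊗[ℚ] V))ˣ)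

lemma mem_latticeImage {L : AddSubgroup V} {v : V} :
    v ∈ latticeImage g L ↔
      (↑g⁻¹ : Module.End FinAdele (FinAdele ⊗[ℚ] V)) ((1 : FinAdele) ⊗ₜ v) ∈ adelicLattice L :=
  Iff.rfl

lemma units_inv_apply (t : FinAdele ⊗[ℚ] V) :
    (↑g⁻¹ : Module.End FinAdele (FinAdele ⊗[ℚ] V)) ((g : Module.End FinAdele _) t) = t := by
  rw [← Module.End.mul_apply, Units.inv_mul, Module.End.one_apply]

lemma units_apply_inv (t : FinAdele ⊗[ℚ] V) :
    (g : Module.End FinAdele (FinAdele ⊗[ℚ] V)) ((↑g⁻¹ : Module.End FinAdele _) t) = t := by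
  rw [← Module.End.mul_apply, Units.mul_inv, Module.End.one_apply]

/-- Denominators N of g and M of g⁻¹ give NL' ⊂ L and ML ⊂ L'. The first inclusion makes L' finitely
generated, the second makes it span V. -/
lemma IsLattice.latticeImage {L : AddSubgroup V} (hL : IsLattice L) :
    IsLattice (latticeImage g L) := by
  obtain ⟨N, hN, hgN⟩ := hL.exists_smul_mem (g : Module.End FinAdele (FinAdele ⊗[ℚ] V))
  obtain ⟨M, hM, hgM⟩ := hL.exists_smul_mem (↑g⁻¹ : Module.End FinAdele (FinAdele ⊗[ℚ] V))
  have hNL : ∀ v ∈ ShimuraBCM.latticeImage g L, N • v ∈ L := fun v hv => by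
    have h := hgN _ ((mem_latticeImage g).1 hv)
    rwa [units_apply_inv, ← TensorProduct.tmul_smul, hL.one_tmul_mem_iff] at h
  have := hL.finite
  refine ⟨?_, ?_⟩
  · let f : ShimuraBCM.latticeImage g L →ₗ[ℤ] L :=
      ((N • LinearMap.id : V →ₗ[ℤ] V).domRestrict
        (ShimuraBCM.latticeImage g L).toIntSubmodule).codRestrict L.toIntSubmodule
        (fun v => hNL v v.2)
    have hf : Function.Injective f := by
      intro x y hxy
      have h1 : N • (x : V) = N • (y : V) := congrArg Subtype.val hxy
      rw [← Nat.cast_smul_eq_nsmul ℚ, ← Nat.cast_smul_eq_nsmul ℚ] at h1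
      exact Subtype.ext (smul_right_injective V (by exact_mod_cast hN : (N : ℚ) ≠ 0) h1)
    have := isNoetherian_of_injective f hf
    infer_instance
  · rw [eq_top_iff, ← hL.span_eq_top, Submodule.span_le]
    intro v hv
    have h1 : M • v ∈ ShimuraBCM.latticeImage g L := by
      rw [mem_latticeImage, TensorProduct.tmul_smul, map_nsmul]
      exact hgM _ (hL.one_tmul_mem_iff.2 hv)
    have h2 : v = (M : ℚ)⁻¹ • (M • v) := by
      rw [← Nat.cast_smul_eq_nsmul ℚ, smul_smul, inv_mul_cancel₀ (by exact_mod_cast hM), one_smul]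
    rw [h2]
    exact Submodule.smul_mem _ _ (Submodule.subset_span h1)

/-- No information is lost in passing to rational vectors: the completion of V ∩ g(L ⊗ ℤ̂) is g(L ⊗
ℤ̂) again, by approximation. -/
lemma IsLattice.mem_adelicLattice_latticeImage {L : AddSubgroup V} (hL : IsLattice L)
    {t : FinAdele ⊗[ℚ] V} : t ∈ adelicLattice (ShimuraBCM.latticeImage g L) ↔
      (↑g⁻¹ : Module.End FinAdele (FinAdele ⊗[ℚ] V)) t ∈ adelicLattice L := by
  constructor
  · intro ht
    refine adelicLattice_induction (S := (adelicLattice L).comap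
      (↑g⁻¹ : Module.End FinAdele (FinAdele ⊗[ℚ] V)).toAddMonoidHom) (fun a ha x hx => ?_) ht
    change (↑g⁻¹ : Module.End FinAdele (FinAdele ⊗[ℚ] V)) (a ⊗ₜ x) ∈
      adelicLattice L
    rw [show a ⊗ₜ[ℚ] x = a • ((1 : FinAdele) ⊗ₜ x) by
      rw [TensorProduct.smul_tmul', smul_eq_mul, mul_one], map_smul]
    exact smul_mem_adelicLattice ha hx
  · intro ht
    obtain ⟨N, hN, hgN⟩ := hL.exists_smul_mem (g : Module.End FinAdele (FinAdele ⊗[ℚ] V))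
    obtain ⟨M, hM, hgM⟩ := hL.exists_smul_mem (↑g⁻¹ : Module.End FinAdele (FinAdele ⊗[ℚ] V))
    have h1 := hgN _ ht
    rw [units_apply_inv] at h1
    -- The modulus is NM because Nt = v + NM·s is divided by N afterwards, and the remaining error
    -- M·s lies in the completion of L'.
    obtain ⟨v, -, s, hs, hvs⟩ := hL.exists_approx h1 (mul_ne_zero hN hM)
    have hNi : algebraMap ℚ FinAdele ((N : ℚ)⁻¹) * algebraMap ℚ FinAdele N = 1 := by
      rw [← map_mul, inv_mul_cancel₀ (by exact_mod_cast hN), map_one]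
    have ht' : t = (1 : FinAdele) ⊗ₜ[ℚ] ((N : ℚ)⁻¹ • v) + M • s := by
      have h2 := congrArg (fun x => algebraMap ℚ FinAdele ((N : ℚ)⁻¹) • x) hvs
      beta_reduce at h2
      rw [smul_add, mul_smul, ← natCast_smul_adele N, ← natCast_smul_adele N, smul_smul, smul_smul,
        hNi, one_smul, one_smul, algebraMap_smul, ← TensorProduct.tmul_smul] at h2
      exact h2
    have hMs : M • s ∈ adelicLattice (ShimuraBCM.latticeImage g L) := by
      refine adelicLattice_induction (S := (adelicLattice (ShimuraBCM.latticeImage g L)).comap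
        (nsmulAddMonoidHom M)) (fun a ha x hx => ?_) hs
      change M • (a ⊗ₜ[ℚ] x) ∈ adelicLattice (ShimuraBCM.latticeImage g L)
      rw [← TensorProduct.tmul_smul]
      refine tmul_mem_adelicLattice ha ?_
      rw [mem_latticeImage, TensorProduct.tmul_smul, map_nsmul]
      exact hgM _ (hL.one_tmul_mem_iff.2 hx)
    rw [ht']
    refine add_mem (tmul_mem_adelicLattice (one_mem _) ?_) hMs
    rw [mem_latticeImage, eq_sub_iff_add_eq.2 ht'.symm, map_sub, map_nsmul]
    exact sub_mem ht (hgM _ hs)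

end Lattices

/-! ### The class number of the stabilizer of a lattice in `GSp` is one -/

section ClassNumber

variable {V : Type*} [AddCommGroup V] [Module ℚ V] {ψ : LinearMap.BilinForm ℚ V}
variable {L L' : AddSubgroup V}

/-- By bilinearity it suffices to clear the denominators of the Gram matrix of a ℤ-basis. -/
lemma IsLattice.exists_natCast_mul_integral (hL : IsLattice L) (ψ : LinearMap.BilinForm ℚ V) :
    ∃ N : ℕ, N ≠ 0 ∧ ∀ x ∈ L, ∀ y ∈ L, ∃ m : ℤ, (m : ℚ) = N * ψ x y := by
  have := hL.finite
  have := hL.free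
  let c := Module.finBasis ℤ L
  refine ⟨∏ i, ∏ j, (ψ (c i) (c j)).den, by simp [Finset.prod_eq_zero_iff], ?_⟩
  set N := ∏ i, ∏ j, (ψ (c i) (c j)).den with hN
  have hbas : ∀ i j, ∃ m : ℤ, (m : ℚ) = N * ψ (c i) (c j) := fun i j => by
    obtain ⟨r, hr⟩ : (ψ (c i) (c j)).den ∣ N :=
      (Finset.dvd_prod_of_mem (fun j => (ψ (c i) (c j)).den) (Finset.mem_univ j)).trans
        (Finset.dvd_prod_of_mem (fun i => ∏ j, (ψ (c i) (c j)).den) (Finset.mem_univ i))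
    refine ⟨r * (ψ (c i) (c j)).num, ?_⟩
    rw [hr]
    push_cast
    rw [mul_comm ((ψ (c i) (c j)).den : ℚ), mul_assoc, Rat.den_mul_eq_num]
  have hsum : ∀ x ∈ L, ∃ a : Fin _ → ℤ, x = ∑ i, a i • (c i : V) := fun x hx => by
    refine ⟨c.repr ⟨x, hx⟩, ?_⟩
    have h := congrArg L.subtype (c.sum_repr ⟨x, hx⟩)
    rw [map_sum] at h
    exact h.symm
  choose m hm using hbas
  intro x hx y hy
  obtain ⟨a, rfl⟩ := hsum x hx
  obtain ⟨a', rfl⟩ := hsum y hy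
  refine ⟨∑ i, ∑ j, a i * (a' j * m i j), ?_⟩
  simp only [map_sum, LinearMap.sum_apply, map_zsmul, LinearMap.smul_apply, Finset.mul_sum,
    Int.cast_sum, Int.cast_mul, hm, zsmul_eq_mul]
  rw [Finset.sum_comm]
  refine Finset.sum_congr rfl fun i _ => Finset.sum_congr rfl fun j _ => ?_
  ring

/-- The form `c ψ` on a lattice on which it is integral. -/
lemma exists_intForm (c : ℚ) (h : ∀ x ∈ L, ∀ y ∈ L, ∃ m : ℤ, (m : ℚ) = c * ψ x y) :
    ∃ B : LinearMap.BilinForm ℤ L, ∀ x y : L, (B x y : ℚ) = c * ψ x y := by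
  choose m hm using fun x y : L => h x x.2 y y.2
  refine ⟨LinearMap.mk₂ ℤ (fun x y => m x y) (fun x x' y => ?_) (fun a x y => ?_)
    (fun x y y' => ?_) (fun a x y => ?_), hm⟩ <;> apply Int.cast_injective (α := ℚ)
  · simp only [Int.cast_add, hm, AddSubgroup.coe_add, map_add, LinearMap.add_apply, mul_add]
  · simp only [smul_eq_mul, Int.cast_mul, hm, AddSubgroup.coe_zsmul, map_zsmul,
      LinearMap.smul_apply, zsmul_eq_mul]
    ring
  · simp only [Int.cast_add, hm, AddSubgroup.coe_add, map_add, mul_add]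
  · simp only [smul_eq_mul, Int.cast_mul, hm, AddSubgroup.coe_zsmul, map_zsmul, zsmul_eq_mul]
    ring

/-- An isomorphism of lattices that is a similitude with multiplier `q` extends to `GSp(ℚ)`. -/
lemma exists_GQ_of_latticeEquiv (hL : IsLattice L) (hL' : IsLattice L') (φ : L ≃ₗ[ℤ] L') {q : ℚ}
    (hq : q ≠ 0) (hφ : ∀ x y, ψ (φ x) (φ y) = q * ψ x y) :
    ∃ T : GQ ψ, (∀ x y, ψ ((T.1 : Module.End ℚ V) x) ((T.1 : Module.End ℚ V) y) = q * ψ x y) ∧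
      ∀ t, GAf.toEnd ψ (toAdelic ψ T) t ∈ adelicLattice L' ↔ t ∈ adelicLattice L := by
  have := hL.finite
  have := hL.free
  let c := Module.finBasis ℤ L
  obtain ⟨b, hb⟩ := hL.exists_basis c
  -- A ℤ-basis of L and its image under φ are both ℚ-bases of V; the rational map T sends one to the
  -- other.
  obtain ⟨b', hb'⟩ := hL'.exists_basis (c.map φ)
  let T := b.equiv b' (Equiv.refl _)
  have hT : ∀ x : L, T x = φ x := by
    have h : T.toLinearMap.toAddMonoidHom.toIntLinearMap ∘ₗ L.subtype.toIntLinearMap =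
        L'.subtype.toIntLinearMap ∘ₗ φ.toLinearMap := c.ext fun i => by
      change T (c i) = φ (c i)
      rw [← hb, b.equiv_apply, Equiv.refl_apply, hb', Module.Basis.map_apply]
    exact fun x => LinearMap.congr_fun h x
  have hT' : ∀ y : L', T.symm y = φ.symm y := fun y => by
    rw [T.symm_apply_eq, hT, φ.apply_symm_apply]
  have hmul : ∀ x y, ψ (T x) (T y) = q * ψ x y := by
    have h : ψ.compl₁₂ T.toLinearMap T.toLinearMap = q • ψ := by
      refine LinearMap.BilinForm.ext_basis b fun i j => ?_
      change ψ (T (b i)) (T (b j)) = q * ψ (b i) (b j)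
      rw [hb, hb, hT, hT, hφ]
    exact fun x y => LinearMap.congr_fun (LinearMap.congr_fun h x) y
  let Tu : (Module.End ℚ V)ˣ := ⟨T.toLinearMap, T.symm.toLinearMap,
    LinearMap.ext fun x => T.apply_symm_apply x, LinearMap.ext fun x => T.symm_apply_apply x⟩
  let TQ : GQ ψ := ⟨Tu, Units.mk0 q hq, hmul⟩
  refine ⟨TQ, hmul, fun t => ?_⟩
  have hA : ∀ (a : FinAdele) (x : V), GAf.toEnd ψ (toAdelic ψ TQ) (a ⊗ₜ x) = a ⊗ₜ T x :=
    fun a x => rfl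
  have hA' : ∀ (a : FinAdele) (x : V), GAf.toEnd ψ (toAdelic ψ TQ⁻¹) (a ⊗ₜ x) = a ⊗ₜ T.symm x :=
    fun a x => rfl
  constructor
  · intro ht
    have h : GAf.toEnd ψ (toAdelic ψ TQ⁻¹) (GAf.toEnd ψ (toAdelic ψ TQ) t) ∈ adelicLattice L := by
      refine adelicLattice_induction (S := (adelicLattice L).comap
        (GAf.toEnd ψ (toAdelic ψ TQ⁻¹)).toAddMonoidHom) (fun a ha x hx => ?_) ht
      change GAf.toEnd ψ (toAdelic ψ TQ⁻¹) (a ⊗ₜ x) ∈ adelicLattice L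
      rw [hA', hT' ⟨x, hx⟩]
      exact tmul_mem_adelicLattice ha (φ.symm ⟨x, hx⟩).2
    rwa [← Module.End.mul_apply, ← map_mul, ← map_mul, inv_mul_cancel, map_one, map_one] at h
  · intro ht
    refine adelicLattice_induction (S := (adelicLattice L').comap
      (GAf.toEnd ψ (toAdelic ψ TQ)).toAddMonoidHom) (fun a ha x hx => ?_) ht
    change GAf.toEnd ψ (toAdelic ψ TQ) (a ⊗ₜ x) ∈ adelicLattice L'
    rw [hA, hT ⟨x, hx⟩]
    exact tmul_mem_adelicLattice ha (φ ⟨x, hx⟩).2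

/-- The vectors `x` of `L ⊗ ℤ̂` such that `s ψ(x, y)` is integral for all `y` in `L ⊗ ℤ̂`. -/
noncomputable def adelicRad (ψ : LinearMap.BilinForm ℚ V) (L : AddSubgroup V) (s : ℚ) :
    AddSubgroup (FinAdele ⊗[ℚ] V) where
  carrier := {x | x ∈ adelicLattice L ∧ ∀ y ∈ adelicLattice L,
    algebraMap ℚ FinAdele s * ψ.baseChange FinAdele x y ∈ intAdele}
  zero_mem' := ⟨zero_mem _, fun y _ => by simp⟩
  add_mem' := fun ha hb => ⟨add_mem ha.1 hb.1, fun y hy => by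
    rw [map_add, LinearMap.add_apply, mul_add]
    exact add_mem (ha.2 y hy) (hb.2 y hy)⟩
  neg_mem' := fun ha => ⟨neg_mem ha.1, fun y hy => by
    rw [map_neg, LinearMap.neg_apply, mul_neg]
    exact neg_mem (ha.2 y hy)⟩

lemma mem_adelicRad {s : ℚ} {x : FinAdele ⊗[ℚ] V} :
    x ∈ adelicRad ψ L s ↔ x ∈ adelicLattice L ∧ ∀ y ∈ adelicLattice L,
      algebraMap ℚ FinAdele s * ψ.baseChange FinAdele x y ∈ intAdele := Iff.rfl

lemma one_tmul_mem_adelicRad_iff (hL : IsLattice L) {s : ℚ} {x : V} (hx : x ∈ L) :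
    (1 : FinAdele) ⊗ₜ[ℚ] x ∈ adelicRad ψ L s ↔ ∀ y ∈ L, ∃ m : ℤ, (m : ℚ) = s * ψ x y := by
  have key : ∀ a y, algebraMap ℚ FinAdele s * ψ.baseChange FinAdele ((1 : FinAdele) ⊗ₜ x)
      (a ⊗ₜ y) = a * algebraMap ℚ FinAdele (s * ψ x y) := fun a y => by
    rw [LinearMap.BilinForm.baseChange_tmul, one_mul, Algebra.smul_def, map_mul]
    ring
  rw [mem_adelicRad, and_iff_right (hL.one_tmul_mem_iff.2 hx)]
  constructor
  · intro h y hy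
    have h1 := h _ (hL.one_tmul_mem_iff.2 hy)
    rwa [key, one_mul, algebraMap_mem_intAdele_iff] at h1
  · intro h y hy
    refine adelicLattice_induction (S := intAdele.toAddSubgroup.comap
      (algebraMap ℚ FinAdele s • ψ.baseChange FinAdele ((1 : FinAdele) ⊗ₜ x)).toAddMonoidHom)
      (fun a ha y hy => ?_) hy
    change algebraMap ℚ FinAdele s * ψ.baseChange FinAdele ((1 : FinAdele) ⊗ₜ x) (a ⊗ₜ y) ∈ intAdele
    rw [key]
    exact mul_mem ha (algebraMap_mem_intAdele_iff.2 (h y hy))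

lemma adelicLattice_le_adelicRad (hL : IsLattice L) {s : ℚ}
    (h : ∀ x ∈ L, ∀ y ∈ L, ∃ m : ℤ, (m : ℚ) = s * ψ x y) :
    adelicLattice L ≤ adelicRad ψ L s := by
  refine adelicLattice_induction fun a ha x hx => ?_
  have h1 := (one_tmul_mem_adelicRad_iff hL hx).2 (h x hx)
  refine ⟨tmul_mem_adelicLattice ha hx, fun y hy => ?_⟩
  rw [show a ⊗ₜ[ℚ] x = a • ((1 : FinAdele) ⊗ₜ x) by
    rw [TensorProduct.smul_tmul', smul_eq_mul, mul_one], map_smul, LinearMap.smul_apply,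
    smul_eq_mul, mul_left_comm]
  exact mul_mem ha (h1.2 y hy)

lemma smul_mem_adelicRad (hL : IsLattice L) {s : ℚ} {N : ℕ}
    (h : ∀ x ∈ L, ∀ y ∈ L, ∃ m : ℤ, (m : ℚ) = N * s * ψ x y) {x : FinAdele ⊗[ℚ] V}
    (hx : x ∈ adelicLattice L) : N • x ∈ adelicRad ψ L s := by
  refine ⟨nsmul_mem hx N, fun y hy => ?_⟩
  rw [← natCast_smul_adele, map_smul, LinearMap.smul_apply, smul_eq_mul, ← mul_assoc, ← map_mul,
    mul_comm s]
  exact (adelicLattice_le_adelicRad hL h hx).2 y hy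

/-- The adelic radical contains N(L ⊗ ℤ̂), so by approximation L and this radical generate L ⊗ ℤ̂.
The quotient of L by its radical modulo N is hence the adelic quotient, which an adelic similitude
can transport. -/
lemma radMod_index_eq_relIndex (hL : IsLattice L) {c : ℚ} {B : LinearMap.BilinForm ℤ L}
    (hB : ∀ x y : L, (B x y : ℚ) = c * ψ x y) {N : ℕ} (hN : N ≠ 0) :
    (radMod B N).index = (adelicRad ψ L (c / N)).relIndex (adelicLattice L) := by
  have hNq : (N : ℚ) ≠ 0 := by exact_mod_cast hN
  let j : L →+ FinAdele ⊗[ℚ] V := (TensorProduct.mk ℚ FinAdele V 1).toAddMonoidHom.comp L.subtype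
  have hj : ∀ x : L, j x = (1 : FinAdele) ⊗ₜ (x : V) := fun _ => rfl
  have hcomap : radMod B N = (adelicRad ψ L (c / N)).comap j := by
    ext x
    rw [AddSubgroup.mem_comap, hj, one_tmul_mem_adelicRad_iff hL x.2, mem_radMod]
    constructor
    · intro h y hy
      obtain ⟨m, hm⟩ := h ⟨y, hy⟩
      refine ⟨m, ?_⟩
      have h1 := hB x ⟨y, hy⟩
      rw [hm] at h1
      push_cast at h1
      field_simp
      linear_combination h1
    · intro h y
      obtain ⟨m, hm⟩ := h y y.2
      refine ⟨m, ?_⟩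
      have h1 := hB x y
      apply Int.cast_injective (α := ℚ)
      push_cast
      rw [h1, hm]
      field_simp
  have hsup : j.range ⊔ adelicRad ψ L (c / N) = adelicLattice L := by
    apply le_antisymm
    · refine sup_le ?_ fun x hx => hx.1
      rintro _ ⟨x, rfl⟩
      exact hL.one_tmul_mem_iff.2 x.2
    · intro t ht
      obtain ⟨v, hv, s, hs, rfl⟩ := hL.exists_approx ht hN
      refine add_mem (AddSubgroup.mem_sup_left ⟨⟨v, hv⟩, rfl⟩) (AddSubgroup.mem_sup_right ?_)
      refine smul_mem_adelicRad hL (fun x hx y hy => ⟨B ⟨x, hx⟩ ⟨y, hy⟩, ?_⟩) hs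
      rw [hB]
      field_simp
  rw [hcomap, AddSubgroup.index_comap, ← AddSubgroup.relIndex_sup_right, hsup]

/-- `g` carries L ⊗ ℤ̂ onto the completion of L' and multiplies ψ by qw. The unit w does not affect
integrality, and q is absorbed by replacing s with s/q. -/
lemma adelicRad_latticeImage (hL : IsLattice L) (g : GAf ψ) {q : ℚ} (hq : q ≠ 0) {w w' : FinAdele}
    (hw : w ∈ intAdele) (hw' : w' ∈ intAdele) (hww : w * w' = 1)
    (hg : ∀ x y, ψ.baseChange FinAdele (GAf.toEnd ψ g x) (GAf.toEnd ψ g y) =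
      algebraMap ℚ FinAdele q * w * ψ.baseChange FinAdele x y) (s : ℚ) :
    (adelicRad ψ (latticeImage g.1 L) (s / q)).relIndex (adelicLattice (latticeImage g.1 L)) =
      (adelicRad ψ L s).relIndex (adelicLattice L) := by
  have hmem : ∀ t, GAf.toEnd ψ g t ∈ adelicLattice (latticeImage g.1 L) ↔ t ∈ adelicLattice L :=
    fun t => by
      rw [hL.mem_adelicLattice_latticeImage]
      change (↑g.1⁻¹ : Module.End FinAdele _) ((g.1 : Module.End FinAdele _) t) ∈ _ ↔ _
      rw [units_inv_apply]
  have hsurj : Function.Surjective (GAf.toEnd ψ g) := fun t => ⟨_, units_apply_inv g.1 t⟩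
  have hinj : Function.Injective (GAf.toEnd ψ g) :=
    Function.LeftInverse.injective (units_inv_apply g.1)
  have hqq : algebraMap ℚ FinAdele (s / q) * algebraMap ℚ FinAdele q = algebraMap ℚ FinAdele s := by
    rw [← map_mul, div_mul_cancel₀ _ hq]
  have h1 : (adelicLattice L).map (GAf.toEnd ψ g).toAddMonoidHom =
      adelicLattice (latticeImage g.1 L) := by
    ext t
    obtain ⟨t, rfl⟩ := hsurj t
    rw [hmem]
    exact AddSubgroup.mem_map_iff_mem hinj
  have h2 : (adelicRad ψ L s).map (GAf.toEnd ψ g).toAddMonoidHom =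
      adelicRad ψ (latticeImage g.1 L) (s / q) := by
    ext t
    obtain ⟨t, rfl⟩ := hsurj t
    refine (AddSubgroup.mem_map_iff_mem hinj).trans ?_
    rw [mem_adelicRad, mem_adelicRad, hmem]
    refine and_congr_right fun _ => Iff.trans (forall_congr' fun y => ?_) hsurj.forall.symm
    rw [hmem, hg]
    refine imp_congr_right fun _ => ?_
    rw [show algebraMap ℚ FinAdele (s / q) * (algebraMap ℚ FinAdele q * w *
      ψ.baseChange FinAdele t y) = w * (algebraMap ℚ FinAdele s * ψ.baseChange FinAdele t y) by
        rw [← hqq]; ring]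
    refine ⟨fun h => mul_mem hw h, fun h => ?_⟩
    have h3 := mul_mem hw' h
    rwa [← mul_assoc, mul_comm w', hww, one_mul] at h3
  rw [← h1, ← h2, AddSubgroup.relIndex_map_map_of_injective _ _ hinj]

/-- Elements of GSp(𝔸_f) and their inverses satisfy the multiplier condition anyway, so only the
stability of L ⊗ ℤ̂ remains. -/
lemma mem_Gamma_iff (ψ : LinearMap.BilinForm ℚ V) (L : AddSubgroup V) {g : GAf ψ} : g ∈ Gamma ψ L ↔
    ∀ t, GAf.toEnd ψ g t ∈ adelicLattice L ↔ t ∈ adelicLattice L := by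
  have hsurj : Function.Surjective (GAf.toEnd ψ g) := fun t => ⟨_, units_apply_inv g.1 t⟩
  have hinv : ∀ t, GAf.toEnd ψ g⁻¹ (GAf.toEnd ψ g t) = t := units_inv_apply g.1
  constructor
  · intro h t
    refine ⟨fun ht => ?_, h.1.2 t⟩
    have := h.2.2 _ ht
    rwa [hinv] at this
  · intro h
    refine ⟨⟨coe_mem_MSp g, fun t ht => (h t).2 ht⟩, coe_mem_MSp g⁻¹, fun t ht => ?_⟩
    obtain ⟨t, rfl⟩ := hsurj t
    rw [hinv]
    exact (h t).1 ht

lemma intForm_isAlt (hψ : ψ.IsAlt) {c : ℚ} {B : LinearMap.BilinForm ℤ L}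
    (hB : ∀ x y : L, (B x y : ℚ) = c * ψ x y) : B.IsAlt := fun x => by
  have := hB x x
  rw [hψ.self_eq_zero, mul_zero] at this
  exact_mod_cast this

lemma intForm_nondegenerate (hL : IsLattice L) (hn : ∀ x, (∀ y, ψ x y = 0) → x = 0) {c : ℚ}
    (hc : c ≠ 0) {B : LinearMap.BilinForm ℤ L} (hB : ∀ x y : L, (B x y : ℚ) = c * ψ x y) (x : L)
    (hx : ∀ y, B x y = 0) : x = 0 := by
  refine Subtype.ext (hn x fun y => ?_)
  have h : (⊤ : Submodule ℚ V) ≤ LinearMap.ker (ψ x) := by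
    rw [← hL.span_eq_top, Submodule.span_le]
    intro z hz
    have h1 := hB x ⟨z, hz⟩
    rw [hx, Int.cast_zero, eq_comm] at h1
    exact (mul_eq_zero.1 h1).resolve_left hc
  exact h (Submodule.mem_top (x := y))

/-- `GSp(𝔸_f) = GSp(ℚ) Γ` for the stabilizer `Γ` of a lattice. -/
theorem exists_GQ_mul_Gamma (hψ : ψ.IsAlt) (hn : ∀ x, (∀ y, ψ x y = 0) → x = 0)
    (hL : IsLattice L) (g : GAf ψ) : ∃ q : GQ ψ, ∃ γ ∈ Gamma ψ L, g = toAdelic ψ q * γ := by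
  obtain ⟨ν, hν⟩ := g.2
  obtain ⟨q, hq, w, hw, w', hw', hww, hνq⟩ := exists_rat_mul_unit ν
  rw [hνq] at hν
  set L' := latticeImage g.1 L with hL'def
  have hL' : IsLattice L' := hL.latticeImage g.1
  obtain ⟨N, hN, hNψ⟩ := hL.exists_natCast_mul_integral ψ
  obtain ⟨N', hN', hNψ'⟩ := hL'.exists_natCast_mul_integral ψ
  have hN0 : (N : ℚ) ≠ 0 := by exact_mod_cast hN
  have hN0' : (N' : ℚ) ≠ 0 := by exact_mod_cast hN'
  have hqn : (q.num : ℚ) ≠ 0 := by exact_mod_cast Rat.num_ne_zero.2 hq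
  -- Both cψ on L and (c/q)ψ on L' have to be integral. The numerator of q in c leaves the integer
  -- NN'·q.den for c/q.
  set c : ℚ := N * N' * q.num with hc
  have hc0 : c ≠ 0 := mul_ne_zero (mul_ne_zero hN0 hN0') hqn
  have hcq : c / q = N * N' * q.den := by
    rw [hc, div_eq_iff hq, mul_assoc, mul_assoc, mul_assoc, Rat.den_mul_eq_num]
  obtain ⟨B, hB⟩ := exists_intForm (L := L) (ψ := ψ) c fun x hx y hy => by
    obtain ⟨m, hm⟩ := hNψ x hx y hy
    exact ⟨N' * q.num * m, by push_cast; rw [hm]; ring⟩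
  obtain ⟨B', hB'⟩ := exists_intForm (L := L') (ψ := ψ) (c / q) fun x hx y hy => by
    obtain ⟨m, hm⟩ := hNψ' x hx y hy
    exact ⟨N * q.den * m, by push_cast; rw [hm, hcq]; ring⟩
  have := hL.finite
  have := hL.free
  have := hL'.finite
  have := hL'.free
  clear_value c
  obtain ⟨φ, hφ⟩ := exists_isometry_of_index_radMod_eq _ hL.finrank hL'.finrank B
    (intForm_isAlt hψ hB) (intForm_nondegenerate hL hn hc0 hB) B' (intForm_isAlt hψ hB')
    (intForm_nondegenerate hL' hn (div_ne_zero hc0 hq) hB') fun M hM => by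
      rw [radMod_index_eq_relIndex hL hB hM, radMod_index_eq_relIndex hL' hB' hM, div_right_comm,
        adelicRad_latticeImage hL g hq hw hw' hww hν]
  -- An isometry from cψ on L to (c/q)ψ on L' multiplies ψ by q.
  obtain ⟨T, -, hT⟩ := exists_GQ_of_latticeEquiv hL hL' φ hq fun x y => by
    have h1 := congrArg (Int.cast : ℤ → ℚ) (hφ x y)
    rw [hB, hB', div_mul_eq_mul_div, div_eq_iff hq, mul_assoc] at h1
    have h2 := mul_left_cancel₀ hc0 h1
    rw [h2, mul_comm]
  -- T and g map L ⊗ ℤ̂ onto the same lattice, so T⁻¹g stabilizes it.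
  refine ⟨T, (toAdelic ψ T)⁻¹ * g, (mem_Gamma_iff ψ L).2 fun t => ?_, by simp⟩
  rw [← hT, ← Module.End.mul_apply, ← map_mul, mul_inv_cancel_left,
    hL.mem_adelicLattice_latticeImage]
  change (↑g.1⁻¹ : Module.End FinAdele _) ((g.1 : Module.End FinAdele _) t) ∈ _ ↔ _
  rw [units_inv_apply]

/-- The stabilizer of a lattice contains an element of `GSp(ℚ)` with multiplier `-1`. -/
theorem exists_GQ_neg_mem_Gamma (hψ : ψ.IsAlt) (hn : ∀ x, (∀ y, ψ x y = 0) → x = 0)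
    (hL : IsLattice L) : ∃ T : GQ ψ, toAdelic ψ T ∈ Gamma ψ L ∧
      ∀ x y, ψ ((T.1 : Module.End ℚ V) x) ((T.1 : Module.End ℚ V) y) = -ψ x y := by
  obtain ⟨N, hN, hNψ⟩ := hL.exists_natCast_mul_integral ψ
  have hN0 : (N : ℚ) ≠ 0 := by exact_mod_cast hN
  obtain ⟨B, hB⟩ := exists_intForm (N : ℚ) hNψ
  have := hL.finite
  have := hL.free
  obtain ⟨φ, hφ⟩ := exists_antiIsometry _ rfl B (intForm_isAlt hψ hB)
    (intForm_nondegenerate hL hn hN0 hB)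
  obtain ⟨T, hT, hT'⟩ := exists_GQ_of_latticeEquiv (q := -1) hL hL φ (by norm_num) fun x y => by
    have h1 := congrArg (Int.cast : ℤ → ℚ) (hφ x y)
    rw [hB, Int.cast_neg, hB, ← mul_neg] at h1
    have h2 := mul_left_cancel₀ hN0 h1
    rw [h2, neg_one_mul]
  exact ⟨T, (mem_Gamma_iff ψ L).2 hT', by simpa using hT⟩

end ClassNumber

/-! ### Symplectic transvections -/

section Transvections

variable {F M : Type*} [Field F] [AddCommGroup M] [Module F M] {B : LinearMap.BilinForm F M}

/-- The symplectic transvection `x ↦ x + a B(v, x) v`. -/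
def sympTransvection (hB : B.IsAlt) (v : M) (a : F) : GSp B :=
  ⟨⟨1 + a • (B v).smulRight v, 1 + (-a) • (B v).smulRight v,
    LinearMap.ext fun x => by simp [hB.self_eq_zero],
    LinearMap.ext fun x => by simp [hB.self_eq_zero]⟩, 1, fun x y => by
      have h := hB.neg_eq v x
      simp [hB.self_eq_zero, ← h]
      ring⟩

lemma sympTransvection_apply (hB : B.IsAlt) (v : M) (a : F) (x : M) :
    ((sympTransvection hB v a).1 : Module.End F M) x = x + (a * B v x) • v := by
  simp [sympTransvection, mul_smul]

lemma GSp.mul_apply (g k : GSp B) (x : M) : ((g * k : GSp B).1 : Module.End F M) x =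
    (g.1 : Module.End F M) ((k.1 : Module.End F M) x) := rfl

/-- The fixed space of an endomorphism. -/
def fixedSpace (f : Module.End F M) : Submodule F M := LinearMap.ker (f - 1)

lemma mem_fixedSpace {f : Module.End F M} {x : M} : x ∈ fixedSpace f ↔ f x = x := by
  rw [fixedSpace, LinearMap.mem_ker, LinearMap.sub_apply, Module.End.one_apply, sub_eq_zero]

/-- The isometries of a nondegenerate alternating form over a field are generated by symplectic
transvections. -/
theorem mem_of_sympTransvection_mem [Module.Finite F M] (hB : B.IsAlt)
    (hn : ∀ x, (∀ y, B x y = 0) → x = 0) (H : Subgroup (GSp B))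
    (hH : ∀ v a, sympTransvection hB v a ∈ H) (g : GSp B)
    (hg : ∀ x y, B ((g.1 : Module.End F M) x) ((g.1 : Module.End F M) y) = B x y) : g ∈ H := by
  -- Induction on a bound k for the codimension of the fixed space of g.
  obtain ⟨k, hk⟩ : ∃ k, Module.finrank F M ≤
      Module.finrank F (fixedSpace (g.1 : Module.End F M)) + k := ⟨_, le_add_self⟩
  induction k generalizing g with
  | zero =>
    have htop : fixedSpace (g.1 : Module.End F M) = ⊤ :=
      Submodule.eq_top_of_finrank_eq (le_antisymm (Submodule.finrank_le _) hk)
    have h1 : g = 1 := Subtype.ext (Units.ext (LinearMap.ext fun x =>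
      mem_fixedSpace.1 (htop ▸ Submodule.mem_top)))
    rw [h1]
    exact one_mem _
  | succ k ih =>
    have hτ : ∀ v a x y, B (((sympTransvection hB v a).1 : Module.End F M) x)
        (((sympTransvection hB v a).1 : Module.End F M) y) = B x y := fun v a x y => by
      simp only [sympTransvection_apply, map_add, map_smul, LinearMap.add_apply,
        LinearMap.smul_apply, smul_eq_mul, hB.self_eq_zero, ← hB.neg_eq v x]
      ring
    have hstep : ∀ g : GSp B,
        (∀ x y, B ((g.1 : Module.End F M) x) ((g.1 : Module.End F M) y) = B x y) →
        Module.finrank F M ≤ Module.finrank F (fixedSpace (g.1 : Module.End F M)) + (k + 1) →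
        (∃ x, B x ((g.1 : Module.End F M) x) ≠ 0) → g ∈ H := by
      rintro g hg hk ⟨x, hx⟩
      set v := (g.1 : Module.End F M) x - x with hv
      -- With v = gx - x one has B(v, gx) = -B(x, gx), so this coefficient makes τ send gx back to
      -- x. Vectors fixed by g are orthogonal to v and stay fixed, so the fixed space of τg is
      -- strictly larger.
      set τ := sympTransvection hB v (B x ((g.1 : Module.End F M) x))⁻¹ with hτdef
      have hmem : τ * g ∈ H := by
        refine ih _ (fun x y => by rw [GSp.mul_apply, GSp.mul_apply, hτ, hg]) ?_
        have hlt : fixedSpace (g.1 : Module.End F M) <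
            fixedSpace ((τ * g).1 : Module.End F M) := by
          refine lt_of_le_of_ne (fun z hz => ?_) fun h => ?_
          · rw [mem_fixedSpace] at hz ⊢
            have h0 : B v z = 0 := by
              rw [hv, map_sub, LinearMap.sub_apply]
              nth_rewrite 1 [← hz]
              rw [hg, sub_self]
            rw [GSp.mul_apply, hz, sympTransvection_apply, h0, mul_zero, zero_smul, add_zero]
          · have hxm : x ∈ fixedSpace (g.1 : Module.End F M) := by
              rw [h, mem_fixedSpace, GSp.mul_apply, sympTransvection_apply, hv, map_sub,
                LinearMap.sub_apply, hB.self_eq_zero, zero_sub, mul_neg, inv_mul_cancel₀ hx]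
              simp
            rw [mem_fixedSpace] at hxm
            exact hx (by rw [hxm, hB.self_eq_zero])
        have := Submodule.finrank_lt_finrank_of_lt hlt
        omega
      have := mul_mem (inv_mem (hH v (B x ((g.1 : Module.End F M) x))⁻¹)) hmem
      rwa [← hτdef, inv_mul_cancel_left] at this
    by_cases h : ∃ x, B x ((g.1 : Module.End F M) x) ≠ 0
    · exact hstep g hg hk h
    -- In the remaining case B(x, gx) = 0 for all x. One transvection along v = gy - y, which does
    -- not shrink the fixed space, leads back to the previous case: B(x, τgx) = B(v, gx)·B(x, v) for
    -- a suitable x.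
    push Not at h
    by_cases h1 : ∀ y, (g.1 : Module.End F M) y = y
    · have h2 : g = 1 := Subtype.ext (Units.ext (LinearMap.ext h1))
      rw [h2]
      exact one_mem _
    push Not at h1
    obtain ⟨y, hy⟩ := h1
    set v := (g.1 : Module.End F M) y - y with hv
    have hv0 : v ≠ 0 := sub_ne_zero.2 hy
    obtain ⟨z, hz⟩ : ∃ z, B v z ≠ 0 := by
      by_contra! hz
      exact hv0 (hn v hz)
    have hskew : ∀ x y, B y x = -B x y := fun x y => (hB.neg_eq x y).symm
    -- Two nonzero linear forms have a common point where neither vanishes; one of z, g⁻¹z and z +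
    -- g⁻¹z will do.
    obtain ⟨x, hx1, hx2⟩ : ∃ x, B v ((g.1 : Module.End F M) x) ≠ 0 ∧ B v x ≠ 0 := by
      have hgz : (g.1 : Module.End F M) (((g⁻¹).1 : Module.End F M) z) = z := by
        rw [← GSp.mul_apply, mul_inv_cancel]; rfl
      by_cases hz1 : B v ((g.1 : Module.End F M) z) = 0
      · by_cases hz2 : B v (((g⁻¹).1 : Module.End F M) z) = 0
        · refine ⟨z + ((g⁻¹).1 : Module.End F M) z, ?_, ?_⟩
          · rwa [map_add, map_add, hz1, hgz, zero_add]
          · rwa [map_add, hz2, add_zero]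
        · exact ⟨_, by rwa [hgz], hz2⟩
      · exact ⟨z, hz1, hz⟩
    set τ := sympTransvection hB v 1 with hτdef
    have hmem : τ * g ∈ H := by
      refine hstep _ (fun x y => by rw [GSp.mul_apply, GSp.mul_apply, hτ, hg]) ?_ ⟨x, ?_⟩
      · have hle : fixedSpace (g.1 : Module.End F M) ≤
            fixedSpace ((τ * g).1 : Module.End F M) := fun z hz => by
          rw [mem_fixedSpace] at hz ⊢
          have h0 : B v z = 0 := by
            rw [hv, map_sub, LinearMap.sub_apply]
            nth_rewrite 1 [← hz]
            rw [hg, sub_self]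
          rw [GSp.mul_apply, hz, sympTransvection_apply, h0, mul_zero, zero_smul, add_zero]
        have := Submodule.finrank_mono hle
        omega
      · rw [GSp.mul_apply, sympTransvection_apply, map_add, h, zero_add, map_smul, one_mul,
          smul_eq_mul, hskew v x, mul_neg]
        exact neg_ne_zero.2 (mul_ne_zero hx1 hx2)
    have := mul_mem (inv_mem (hH v 1)) hmem
    rwa [← hτdef, inv_mul_cancel_left] at this

end Transvections

/-! ### The identity component of `GSp(ℝ)` -/

section RealGroup

variable {V : Type*} [AddCommGroup V] [Module ℚ V] {ψ : LinearMap.BilinForm ℚ V}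

lemma mem_connectedComponentOfOne_of_continuous {G : Type*} [Group G] [TopologicalSpace G]
    [IsTopologicalGroup G] (f : ℝ → G) (hf : Continuous f) (h0 : f 0 = 1) (t : ℝ) :
    f t ∈ Subgroup.connectedComponentOfOne G :=
  (isPreconnected_range hf).subset_connectedComponent ⟨0, h0⟩ ⟨t, rfl⟩

lemma continuous_sympTransvection (hR : (ψ.baseChange ℝ).IsAlt) (v : ℝ ⊗[ℚ] V) :
    Continuous fun a : ℝ => (sympTransvection hR v a : GR ψ) := by
  have : ContinuousAdd (Module.End ℝ (ℝ ⊗[ℚ] V)) := IsModuleTopology.toContinuousAdd ℝ _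
  refine Continuous.subtype_mk (Units.continuous_iff.2 ⟨?_, ?_⟩) _
  · exact continuous_const.add (continuous_id.smul continuous_const)
  · exact continuous_const.add (continuous_neg.smul continuous_const)

/-- Multiplication by `exp t` on `ℝ ⊗ V`. -/
noncomputable def expScalar (ψ : LinearMap.BilinForm ℚ V) (t : ℝ) : GR ψ :=
  ⟨⟨Real.exp t • 1, Real.exp (-t) • 1, by
      rw [smul_mul_smul_comm, ← Real.exp_add, add_neg_cancel, Real.exp_zero, one_smul, one_mul], by
      rw [smul_mul_smul_comm, ← Real.exp_add, neg_add_cancel, Real.exp_zero, one_smul, one_mul]⟩,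
    Units.mk0 (Real.exp t * Real.exp t) (by positivity), fun x y => by
      simp [mul_assoc]⟩

lemma continuous_expScalar : Continuous (expScalar ψ) := by
  refine Continuous.subtype_mk (Units.continuous_iff.2 ⟨?_, ?_⟩) _
  · exact Real.continuous_exp.smul continuous_const
  · exact (Real.continuous_exp.comp continuous_neg).smul continuous_const

lemma expScalar_zero : expScalar ψ 0 = 1 :=
  Subtype.ext (Units.ext (by simp [expScalar]; rfl))

variable [Module.Finite ℚ V]

/-- Scaling by ν^(-1/2), which is joined to 1 through the positive scalars, turns g into an
isometry. This is a product of transvections, each joined to 1 by letting its coefficient tend to 0.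
-/
lemma mem_connectedComponentOfOne_of_pos (hR : (ψ.baseChange ℝ).IsAlt)
    (hn : ∀ x, (∀ y, ψ.baseChange ℝ x y = 0) → x = 0) (g : GR ψ) {ν : ℝ} (hν : 0 < ν)
    (hg : ∀ x y, ψ.baseChange ℝ ((g.1 : Module.End ℝ (ℝ ⊗[ℚ] V)) x)
      ((g.1 : Module.End ℝ (ℝ ⊗[ℚ] V)) y) = ν * ψ.baseChange ℝ x y) :
    g ∈ Subgroup.connectedComponentOfOne (GR ψ) := by
  set s := expScalar ψ (-(Real.log ν / 2)) with hs
  have hsmem : s ∈ Subgroup.connectedComponentOfOne (GR ψ) :=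
    mem_connectedComponentOfOne_of_continuous _ continuous_expScalar expScalar_zero _
  have hmem : s * g ∈ Subgroup.connectedComponentOfOne (GR ψ) := by
    refine mem_of_sympTransvection_mem hR hn (Subgroup.connectedComponentOfOne (GR ψ))
      (fun v a => ?_) (s * g) fun x y => ?_
    · refine mem_connectedComponentOfOne_of_continuous
        (fun a : ℝ => (sympTransvection hR v a : GR ψ)) (continuous_sympTransvection hR v) ?_ a
      exact Subtype.ext (Units.ext (by simp [sympTransvection]))
    · change ψ.baseChange ℝ (Real.exp _ • (g.1 : Module.End ℝ (ℝ ⊗[ℚ] V)) x)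
        (Real.exp _ • (g.1 : Module.End ℝ (ℝ ⊗[ℚ] V)) y) = _
      rw [map_smul, map_smul, LinearMap.smul_apply, hg, smul_eq_mul, smul_eq_mul, ← mul_assoc,
        ← mul_assoc, ← Real.exp_add, ← neg_add, add_halves, Real.exp_neg, Real.exp_log hν,
        inv_mul_cancel₀ hν.ne', one_mul]
  have := mul_mem (inv_mem hsmem) hmem
  rwa [inv_mul_cancel_left] at this

lemma continuous_bilinForm_apply (B : LinearMap.BilinForm ℝ (ℝ ⊗[ℚ] V)) (x y : ℝ ⊗[ℚ] V) :
    Continuous fun f : Module.End ℝ (ℝ ⊗[ℚ] V) => B (f x) (f y) := by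
  have h := IsModuleTopology.continuous_bilinear_of_finite_left
    (B.compl₁₂ (LinearMap.applyₗ x : Module.End ℝ (ℝ ⊗[ℚ] V) →ₗ[ℝ] _)
      (LinearMap.applyₗ y : Module.End ℝ (ℝ ⊗[ℚ] V) →ₗ[ℝ] _))
  exact h.comp (continuous_id.prodMk continuous_id)

lemma continuous_form_apply (x y : ℝ ⊗[ℚ] V) :
    Continuous fun g : GR ψ => ψ.baseChange ℝ ((g.1 : Module.End ℝ (ℝ ⊗[ℚ] V)) x)
      ((g.1 : Module.End ℝ (ℝ ⊗[ℚ] V)) y) :=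
  (continuous_bilinForm_apply (ψ.baseChange ℝ) x y).comp
    (Units.continuous_val.comp continuous_subtype_val)

/-- ψ(gx, gy) = νψ(x, y) is continuous in g and never vanishes. A fixed pair x, y thus tests the
sign of the multiplier. -/
lemma isClopen_pos {x y : ℝ ⊗[ℚ] V} (hxy : ψ.baseChange ℝ x y ≠ 0) :
    IsClopen {g : GR ψ | 0 < ψ.baseChange ℝ ((g.1 : Module.End ℝ (ℝ ⊗[ℚ] V)) x)
      ((g.1 : Module.End ℝ (ℝ ⊗[ℚ] V)) y)} := by
  have hc := continuous_form_apply (ψ := ψ) x y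
  refine ⟨⟨?_⟩, isOpen_lt continuous_const hc⟩
  convert! isOpen_lt hc (continuous_const (y := (0 : ℝ))) using 1
  ext g
  obtain ⟨ν, hν⟩ := g.2
  have h0 : ψ.baseChange ℝ ((g.1 : Module.End ℝ (ℝ ⊗[ℚ] V)) x)
      ((g.1 : Module.End ℝ (ℝ ⊗[ℚ] V)) y) ≠ 0 := by
    rw [hν]
    exact mul_ne_zero ν.ne_zero hxy
  simp only [Set.mem_compl_iff, Set.mem_ofPred_eq, not_lt]
  exact h0.le_iff_lt

/-- The identity component of `GSp(ℝ)` consists of the similitudes with positive multiplier. -/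
theorem mem_connectedComponentOfOne_iff (hR : (ψ.baseChange ℝ).IsAlt)
    (hn : ∀ x, (∀ y, ψ.baseChange ℝ x y = 0) → x = 0) {x y : ℝ ⊗[ℚ] V}
    (hxy : 0 < ψ.baseChange ℝ x y) (g : GR ψ) :
    g ∈ Subgroup.connectedComponentOfOne (GR ψ) ↔
      0 < ψ.baseChange ℝ ((g.1 : Module.End ℝ (ℝ ⊗[ℚ] V)) x)
        ((g.1 : Module.End ℝ (ℝ ⊗[ℚ] V)) y) := by
  constructor
  · exact fun hg => (isClopen_pos hxy.ne').connectedComponent_subset (x := (1 : GR ψ)) hxy hg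
  · intro h
    obtain ⟨ν, hν⟩ := g.2
    rw [hν] at h
    exact mem_connectedComponentOfOne_of_pos hR hn g (pos_of_mul_pos_left h hxy.le) hν

end RealGroup

/-! ### The form of a family of CM types over the real numbers -/

section CMForm

open ComplexEmbedding

/-- The trace is the sum over all complex embeddings, which fall into pairs φ, ιφ with φ ∈ Φ. -/
lemma CMType.trace_eq_sum {K : Type*} [Field K] [NumberField K] (Φ : CMType K) [Fintype Φ.carrier]
    (a : K) : ((Algebra.trace ℚ K a : ℚ) : ℝ) = ∑ φ : Φ.carrier, 2 * (φ.1 a).re := by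
  have hbij : Function.Bijective (Sum.elim (fun φ : Φ.carrier => φ.1)
      (fun φ : Φ.carrier => conjugate φ.1)) := by
    constructor
    · have hdisj : ∀ φ ψ : Φ.carrier, φ.1 ≠ conjugate ψ.1 := fun φ ψ h => by
        have : φ.1 ∈ Φ.carrier ∩ conjugate '' Φ.carrier := ⟨φ.2, ψ.1, ψ.2, h.symm⟩
        rwa [Φ.inter_conj] at this
      rintro (φ | φ) (χ | χ) h
      · exact congrArg Sum.inl (Subtype.ext h)
      · exact (hdisj φ χ h).elim
      · exact (hdisj χ φ h.symm).elim
      · exact congrArg Sum.inr (Subtype.ext (by simpa using congrArg conjugate h))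
    · intro φ
      have hmem : φ ∈ Φ.carrier ∪ conjugate '' Φ.carrier := by
        rw [Φ.union_conj]; trivial
      rcases hmem with h | ⟨χ, h, rfl⟩
      · exact ⟨Sum.inl ⟨φ, h⟩, rfl⟩
      · exact ⟨Sum.inr ⟨χ, h⟩, rfl⟩
  have h1 : ((Algebra.trace ℚ K a : ℚ) : ℂ) = ∑ φ : K →+* ℂ, φ a := by
    have h2 := trace_eq_sum_embeddings ℂ (K := ℚ) (L := K) (x := a)
    rw [eq_ratCast] at h2
    rw [h2]
    exact Fintype.sum_equiv (RingHom.equivRatAlgHom K ℂ).symm _ _ fun _ => rfl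
  rw [← Fintype.sum_bijective _ hbij (fun s => Sum.elim (fun φ : Φ.carrier => φ.1)
      (fun φ : Φ.carrier => conjugate φ.1) s a) _ (fun _ => rfl), Fintype.sum_sum_type,
    ← Finset.sum_add_distrib] at h1
  have h3 := congrArg Complex.re h1
  rw [Complex.re_sum, Complex.ratCast_re] at h3
  rw [h3]
  refine Finset.sum_congr rfl fun φ _ => ?_
  simp [two_mul]

variable {ι : Type*} [Fintype ι] {E : ι → Type*} [∀ i, Field (E i)] [∀ i, NumberField (E i)]

/-- `L = ⨁ i, 𝓞 (E i)` is a lattice. -/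
lemma isLattice_latticeO : IsLattice (latticeO E) := by
  classical
  have hmem : ∀ x : ∀ i, E i, x ∈ latticeO E ↔ ∀ i, ∃ a : 𝓞 (E i), algebraMap _ _ a = x i := by
    intro x
    simp [latticeO, AddSubgroup.mem_pi]
  constructor
  · let f : (∀ i, 𝓞 (E i)) →+ latticeO E :=
      { toFun a := ⟨fun i => algebraMap _ _ (a i), (hmem _).2 fun i => ⟨a i, rfl⟩⟩
        map_zero' := Subtype.ext (funext fun i => map_zero _)
        map_add' a b := Subtype.ext (funext fun i => map_add _ _ _) }
    refine Module.Finite.of_surjective f.toIntLinearMap ?_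
    rintro ⟨x, hx⟩
    choose a ha using (hmem x).1 hx
    exact ⟨a, Subtype.ext (funext ha)⟩
  · rw [eq_top_iff]
    intro x _
    rw [← Finset.univ_sum_single x]
    refine sum_mem fun i _ => ?_
    have h : (⊤ : Submodule ℚ (E i)) ≤
        (Submodule.span ℚ (latticeO E : Set (∀ i, E i))).comap (LinearMap.single ℚ E i) := by
      rw [← (integralBasis (E i)).span_eq, Submodule.span_le]
      rintro _ ⟨k, rfl⟩
      refine Submodule.subset_span ((hmem _).2 fun j => ?_)
      rw [LinearMap.single_apply]
      rcases eq_or_ne j i with rfl | hj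
      · exact ⟨RingOfIntegers.basis (E j) k, by rw [Pi.single_eq_same, integralBasis_apply]⟩
      · exact ⟨0, by rw [Pi.single_eq_of_ne hj, map_zero]⟩
    exact h (Submodule.mem_top (x := x i))

variable [DecidableEq ι] (Φ : ∀ i, CMType (E i))

/-- The coordinate of an element of `ℝ ⊗ ∏ i, E i` at an embedding in `Φ i`. -/
noncomputable def cmCoord (i : ι) (φ : (Φ i).carrier) : ℝ ⊗[ℚ] (∀ i, E i) →ₐ[ℝ] ℂ :=
  (Pi.evalAlgHom ℝ _ φ).comp ((Φ i).toProd.comp ((Pi.evalAlgHom ℝ _ i).comp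
    (Algebra.TensorProduct.piRight ℚ ℝ ℝ E).toAlgHom))

lemma cmCoord_tmul (i : ι) (φ : (Φ i).carrier) (r : ℝ) (x : ∀ i, E i) :
    cmCoord Φ i φ (r ⊗ₜ x) = r * φ.1 (x i) := by
  change (Φ i).toProd (Algebra.TensorProduct.piRight ℚ ℝ ℝ E (r ⊗ₜ x) i) φ = _
  rw [Algebra.TensorProduct.piRight_tmul, CMType.toProd_tmul]

lemma eq_zero_of_cmCoord {x : ℝ ⊗[ℚ] (∀ i, E i)} (h : ∀ i φ, cmCoord Φ i φ x = 0) : x = 0 := by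
  apply (Algebra.TensorProduct.piRight ℚ ℝ ℝ E).injective
  funext i
  apply (Φ i).toProd_injective
  funext φ
  rw [map_zero, Pi.zero_apply, map_zero]
  exact h i φ

variable [∀ i, IsCMField (E i)] (ξ : ∀ i, E i)

lemma psi_baseChange_eq_sum [∀ i, Fintype (Φ i).carrier] (x y : ℝ ⊗[ℚ] (∀ i, E i)) :
    (psi ξ).baseChange ℝ x y = ∑ i, ∑ φ : (Φ i).carrier,
      2 * (φ.1 (ξ i) * cmCoord Φ i φ x * starRingEnd ℂ (cmCoord Φ i φ y)).re := by
  induction x using TensorProduct.induction_on with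
  | zero => simp
  | add x₁ x₂ h₁ h₂ =>
    simp only [map_add, LinearMap.add_apply, h₁, h₂, mul_add, add_mul, Complex.add_re,
      Finset.sum_add_distrib]
  | tmul r x =>
    induction y using TensorProduct.induction_on with
    | zero => simp
    | add y₁ y₂ h₁ h₂ =>
      simp only [map_add, h₁, h₂, mul_add, Complex.add_re, Finset.sum_add_distrib]
    | tmul s y =>
      rw [LinearMap.BilinForm.baseChange_tmul, Rat.smul_def, psi, LinearMap.mk₂_apply, Rat.cast_sum,
        Finset.sum_mul]
      refine Finset.sum_congr rfl fun i _ => ?_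
      rw [(Φ i).trace_eq_sum, Finset.sum_mul]
      refine Finset.sum_congr rfl fun φ _ => ?_
      have h : φ.1 (ξ i) * ((r : ℂ) * φ.1 (x i)) * starRingEnd ℂ ((s : ℂ) * φ.1 (y i)) =
          ((r * s : ℝ) : ℂ) * φ.1 (ξ i * x i * IsCMField.complexConj (E i) (y i)) := by
        rw [map_mul, map_mul, IsCMField.complexEmbedding_complexConj, map_mul, Complex.conj_ofReal]
        push_cast
        ring
      rw [cmCoord_tmul, cmCoord_tmul, h, Complex.re_ofReal_mul]
      ring

lemma cmCoord_hAlg_mul (z : ℂ) (x : ℝ ⊗[ℚ] (∀ i, E i)) (i : ι) (φ : (Φ i).carrier) :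
    cmCoord Φ i φ (hAlg Φ z * x) = z * cmCoord Φ i φ x := by
  rw [map_mul]
  congr 1
  exact toProd_hAlg Φ z i φ

/-- In each coordinate φ(ξ) is purely imaginary and is multiplied by the real number |x_φ|². -/
lemma psi_baseChange_isAlt (Φ : ∀ i, CMType (E i)) (ξ : ∀ i, E i)
    (himag : ∀ i, IsCMField.complexConj (E i) (ξ i) = -ξ i) :
    ((psi ξ).baseChange ℝ).IsAlt := by
  intro x
  have : ∀ i, Fintype (Φ i).carrier := fun _ => Fintype.ofFinite _
  rw [psi_baseChange_eq_sum Φ]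
  refine Finset.sum_eq_zero fun i _ => Finset.sum_eq_zero fun φ _ => ?_
  have h := IsCMField.complexEmbedding_complexConj (E i) φ.1 (ξ i)
  rw [himag, map_neg] at h
  have h1 := congrArg Complex.re h
  rw [Complex.neg_re, Complex.conj_re] at h1
  rw [mul_assoc, Complex.mul_conj, Complex.re_mul_ofReal, show (φ.1 (ξ i)).re = 0 by linarith]
  simp

lemma psi_isAlt (Φ : ∀ i, CMType (E i)) (ξ : ∀ i, E i)
    (himag : ∀ i, IsCMField.complexConj (E i) (ξ i) = -ξ i) : (psi ξ).IsAlt := by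
  intro x
  have h := psi_baseChange_isAlt Φ ξ himag ((1 : ℝ) ⊗ₜ x)
  rw [LinearMap.BilinForm.baseChange_tmul, Rat.smul_def, mul_one, mul_one] at h
  exact_mod_cast h

/-- Conjugation turns the factor i into -i, and Re(-iφ(ξ)) = Im φ(ξ). -/
lemma psi_baseChange_hAlg_I [∀ i, Fintype (Φ i).carrier] (x : ℝ ⊗[ℚ] (∀ i, E i)) :
    (psi ξ).baseChange ℝ x (hAlg Φ Complex.I * x) = ∑ i, ∑ φ : (Φ i).carrier,
      2 * ((φ.1 (ξ i)).im * Complex.normSq (cmCoord Φ i φ x)) := by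
  rw [psi_baseChange_eq_sum Φ]
  refine Finset.sum_congr rfl fun i _ => Finset.sum_congr rfl fun φ _ => ?_
  rw [cmCoord_hAlg_mul, map_mul, Complex.conj_I, mul_assoc, mul_left_comm (cmCoord Φ i φ x),
    Complex.mul_conj, ← mul_assoc, Complex.re_mul_ofReal]
  simp

/-- The form `ψ(x, h(i) y)` is definite. -/
lemma exists_pos_mul_psi_hAlg (hpol : (∀ i, ∀ φ ∈ (Φ i).carrier, 0 < (φ (ξ i)).im) ∨
    (∀ i, ∀ φ ∈ (Φ i).carrier, (φ (ξ i)).im < 0)) :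
    ∃ ε : ℝ, ∀ x ≠ 0, 0 < ε * (psi ξ).baseChange ℝ x (hAlg Φ Complex.I * x) := by
  obtain ⟨ε, hε⟩ : ∃ ε : ℝ, ∀ i, ∀ φ ∈ (Φ i).carrier, 0 < ε * (φ (ξ i)).im := by
    rcases hpol with h | h
    · exact ⟨1, fun i φ hφ => by simpa using h i φ hφ⟩
    · exact ⟨-1, fun i φ hφ => by simpa using h i φ hφ⟩
  refine ⟨ε, fun x hx => ?_⟩
  have : ∀ i, Fintype (Φ i).carrier := fun _ => Fintype.ofFinite _
  have hterm : ∀ i (φ : (Φ i).carrier),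
      0 ≤ ε * (2 * ((φ.1 (ξ i)).im * Complex.normSq (cmCoord Φ i φ x))) := fun i φ => by
    rw [mul_left_comm, ← mul_assoc ε]
    exact mul_nonneg zero_le_two (mul_nonneg (hε i φ.1 φ.2).le (Complex.normSq_nonneg _))
  obtain ⟨i, φ, hφ⟩ : ∃ i φ, cmCoord Φ i φ x ≠ 0 := by
    by_contra! h
    exact hx (eq_zero_of_cmCoord Φ h)
  rw [psi_baseChange_hAlg_I, Finset.mul_sum]
  refine Finset.sum_pos' (fun i _ => ?_) ⟨i, Finset.mem_univ i, ?_⟩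
  · rw [Finset.mul_sum]
    exact Finset.sum_nonneg fun φ _ => hterm i φ
  · rw [Finset.mul_sum]
    refine Finset.sum_pos' (fun φ _ => hterm i φ) ⟨φ, Finset.mem_univ φ, ?_⟩
    rw [mul_left_comm, ← mul_assoc ε]
    exact mul_pos two_pos (mul_pos (hε i φ.1 φ.2) (Complex.normSq_pos.2 hφ))

variable {ξ} {Φ} {ε : ℝ}

/-- A nonzero x pairs nontrivially with h(i)x. -/
lemma psi_baseChange_nondegenerate
    (hε : ∀ x ≠ 0, 0 < ε * (psi ξ).baseChange ℝ x (hAlg Φ Complex.I * x))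
    (x : ℝ ⊗[ℚ] (∀ i, E i)) (hx : ∀ y, (psi ξ).baseChange ℝ x y = 0) : x = 0 := by
  by_contra h
  have := hε x h
  rw [hx, mul_zero] at this
  exact this.false

lemma psi_nondegenerate
    (hε : ∀ x ≠ 0, 0 < ε * (psi ξ).baseChange ℝ x (hAlg Φ Complex.I * x))
    (x : ∀ i, E i) (hx : ∀ y, psi ξ x y = 0) : x = 0 := by
  have h : (1 : ℝ) ⊗ₜ[ℚ] x = 0 := psi_baseChange_nondegenerate hε _ fun y => by
    induction y using TensorProduct.induction_on with
    | zero => simp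
    | add y₁ y₂ h₁ h₂ => rw [map_add, h₁, h₂, add_zero]
    | tmul s y => rw [LinearMap.BilinForm.baseChange_tmul, hx, zero_smul]
  exact (Module.FaithfullyFlat.one_tmul_eq_zero_iff ℚ _ _).1 h

/-- An element of `GSp(ℝ)` that centralizes `h_cm` has positive multiplier. -/
lemma pos_of_conj_hcm_eq
    (hε : ∀ x ≠ 0, 0 < ε * (psi ξ).baseChange ℝ x (hAlg Φ Complex.I * x))
    {g : GR (psi ξ)} (hg : (MulAut.conj g).toMonoidHom.comp (hcm Φ ξ) = hcm Φ ξ)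
    {x y : ℝ ⊗[ℚ] (∀ i, E i)} (hxy : 0 < (psi ξ).baseChange ℝ x y) :
    0 < (psi ξ).baseChange ℝ ((g.1 : Module.End ℝ (ℝ ⊗[ℚ] (∀ i, E i))) x)
      ((g.1 : Module.End ℝ (ℝ ⊗[ℚ] (∀ i, E i))) y) := by
  obtain ⟨ν, hν⟩ := g.2
  have hx0 : x ≠ 0 := by
    rintro rfl
    simp at hxy
  have hcomm : g * hcm Φ ξ (Units.mk0 Complex.I Complex.I_ne_zero) =
      hcm Φ ξ (Units.mk0 Complex.I Complex.I_ne_zero) * g := by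
    have h := DFunLike.congr_fun hg (Units.mk0 Complex.I Complex.I_ne_zero)
    exact mul_inv_eq_iff_eq_mul.1 h
  have hJ : ∀ z, (g.1 : Module.End ℝ (ℝ ⊗[ℚ] (∀ i, E i))) (hAlg Φ Complex.I * z) =
      hAlg Φ Complex.I * (g.1 : Module.End ℝ (ℝ ⊗[ℚ] (∀ i, E i))) z := fun z =>
    congrArg (fun k : GR (psi ξ) => (k.1 : Module.End ℝ (ℝ ⊗[ℚ] (∀ i, E i))) z) hcomm
  have hgx : (g.1 : Module.End ℝ (ℝ ⊗[ℚ] (∀ i, E i))) x ≠ 0 := fun h0 => by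
    have h1 := hν x y
    rw [h0, map_zero, LinearMap.zero_apply] at h1
    exact mul_ne_zero ν.ne_zero hxy.ne' h1.symm
  -- Since g commutes with h(i), ψ(gx, h(i)gx) = νψ(x, h(i)x). Definiteness gives both values the
  -- same sign, so ν > 0.
  have h1 := hε _ hgx
  rw [← hJ, hν, mul_left_comm] at h1
  rw [hν]
  exact mul_pos (pos_of_mul_pos_left h1 (hε x hx0).le) hxy

lemma exists_psi_baseChange_pos [Nonempty ι]
    (hε : ∀ x ≠ 0, 0 < ε * (psi ξ).baseChange ℝ x (hAlg Φ Complex.I * x)) :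
    ∃ x y, 0 < (psi ξ).baseChange ℝ x y := by
  have h1 : (1 : ℝ) ⊗ₜ[ℚ] (1 : ∀ i, E i) ≠ 0 := fun h =>
    one_ne_zero ((Module.FaithfullyFlat.one_tmul_eq_zero_iff ℚ _ _).1 h)
  refine ⟨(1 : ℝ) ⊗ₜ[ℚ] (1 : ∀ i, E i), ε • (hAlg Φ Complex.I * ((1 : ℝ) ⊗ₜ[ℚ] (1 : ∀ i, E i))), ?_⟩
  rw [map_smul]
  exact hε _ h1

end CMForm

/-! ### Comparison of the groupoids -/

section Comparison

variable {V : Type*} [AddCommGroup V] [Module ℚ V]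
variable {ψ : LinearMap.BilinForm ℚ V} {L : AddSubgroup V} {h : ℂˣ →* GR ψ}

lemma X.smul_ofGroup (g k : GR ψ) : g • X.ofGroup h k = X.ofGroup h (g * k) := by
  refine Subtype.ext ?_
  change (MulAut.conj g).toMonoidHom.comp ((MulAut.conj k).toMonoidHom.comp h) =
    (MulAut.conj (g * k)).toMonoidHom.comp h
  ext z; simp

lemma X.toReal_smul (q : GQ ψ) (x : X h) : q • x = toReal ψ q • x := rfl

lemma X.exists_ofGroup (x : X h) : ∃ g, X.ofGroup h g = x :=
  x.2.imp fun _ hg => Subtype.ext hg.symm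

lemma X.ofGroup_one : X.ofGroup h 1 = X.base h :=
  Subtype.ext (by ext z; simp [X.ofGroup, X.base])

lemma X.continuous_ofGroup : Continuous (X.ofGroup h) := continuous_coinduced_rng

lemma Sh.continuous_mk : Continuous fun p : X h × GAf ψ => Sh.mk h p.1 p.2 :=
  continuous_quotient_mk'

lemma GAf.continuous_toEnd : Continuous (GAf.toEnd ψ) :=
  Units.continuous_val.comp continuous_subtype_val

lemma Gamma.continuous_toGammaM : Continuous (Gamma.toGammaM L : Gamma ψ L → GammaM ψ L) := by
  have h1 : Continuous fun γ : Gamma ψ L => GAf.toEnd ψ γ :=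
    GAf.continuous_toEnd.comp continuous_subtype_val
  exact h1.subtype_mk _

/-- The class of a point of `U`. -/
noncomputable def Z.mk (u : U L h) : Z L h := Quotient.mk _ u

lemma Z.mk_eq_iff {u v : U L h} :
    Z.mk u = Z.mk v ↔ ∃ γ : Gamma ψ L × Gamma ψ L, γ • v = u := Quotient.eq

lemma Z.mk_smul (γ : Gamma ψ L × Gamma ψ L) (u : U L h) : Z.mk (γ • u) = Z.mk u :=
  Z.mk_eq_iff.2 ⟨γ, rfl⟩

variable [Module.Finite ℚ V]

/-- The class of a point of `U⁺`. -/
noncomputable def Zplus.mk (u : Uplus L h) : Zplus L h := Quotient.mk _ u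

lemma naturalZ_mk (u : Uplus L h) : naturalZ L h (Zplus.mk u) = Z.mk (naturalU L h u) := rfl

/-- In a basis of L, stability of L ⊗ ℤ̂ means that finitely many matrix entries lie in the open
subring ℤ̂. This is imposed on g and on g⁻¹. -/
lemma isOpen_Gamma (hL : IsLattice L) : IsOpen (Gamma ψ L : Set (GAf ψ)) := by
  obtain ⟨n, b, hb⟩ := hL.exists_rat_basis
  let e := Algebra.TensorProduct.basis FinAdele b
  have he : ∀ i, e i ∈ adelicLattice L := fun i => (mem_adelicLattice_iff hb).2 fun k => by
    rw [e.repr_self, Finsupp.single_apply]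
    split_ifs
    exacts [one_mem _, zero_mem _]
  have hS : IsOpen {f : Module.End FinAdele (FinAdele ⊗[ℚ] V) |
      ∀ t ∈ adelicLattice L, f t ∈ adelicLattice L} := by
    have heq : {f : Module.End FinAdele (FinAdele ⊗[ℚ] V) |
        ∀ t ∈ adelicLattice L, f t ∈ adelicLattice L} =
        ⋂ (i) (j), (fun f : Module.End FinAdele (FinAdele ⊗[ℚ] V) => e.coord j (f (e i))) ⁻¹'
          (intAdele : Set FinAdele) := by
      ext f
      simp only [Set.mem_iInter, Set.mem_preimage, SetLike.mem_coe, Set.mem_ofPred_eq]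
      constructor
      · intro hf i j
        exact (mem_adelicLattice_iff hb).1 (hf _ (he i)) j
      · intro hf t ht
        rw [← e.sum_repr t, map_sum]
        refine sum_mem fun i _ => ?_
        rw [map_smul]
        exact smul_mem_adelicLattice ((mem_adelicLattice_iff hb).1 ht i)
          ((mem_adelicLattice_iff hb).2 (hf i))
    rw [heq]
    refine isOpen_iInter_of_finite fun i => isOpen_iInter_of_finite fun j => ?_
    exact isOpen_intAdele.preimage (IsModuleTopology.continuous_of_linearMap
      ((e.coord j).comp (LinearMap.applyₗ (e i))))
  have hc := GAf.continuous_toEnd (ψ := ψ)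
  convert! (hS.preimage hc).inter (hS.preimage (hc.comp continuous_inv)) using 1
  ext g
  exact ⟨fun hg => ⟨hg.1.2, hg.2.2⟩, fun hg => ⟨⟨coe_mem_MSp g, hg.1⟩, coe_mem_MSp g⁻¹, hg.2⟩⟩

lemma X.continuous_smul (g : GR ψ) : Continuous fun x : X h => g • x := by
  refine continuous_coinduced_dom.2 ?_
  have e : (fun x : X h => g • x) ∘ X.ofGroup h = X.ofGroup h ∘ fun k => g * k :=
    funext fun k => X.smul_ofGroup g k
  rw [e]
  exact X.continuous_ofGroup.comp (continuous_const_mul g)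

/-- The stabilizer of h lies in the identity component, so the orbit of h under that component has
the component itself as preimage in GSp(ℝ). The orbit is therefore open and closed as well as
connected, that is, equal to X⁺. -/
lemma ofGroup_mem_Xplus_iff
    (hopen : IsOpen (Subgroup.connectedComponentOfOne (GR ψ) : Set (GR ψ)))
    (hstab : ∀ g : GR ψ, (MulAut.conj g).toMonoidHom.comp h = h →
      g ∈ Subgroup.connectedComponentOfOne (GR ψ)) (g : GR ψ) :
    X.ofGroup h g ∈ Xplus h ↔ g ∈ Subgroup.connectedComponentOfOne (GR ψ) := by
  set S : Set (X h) := X.ofGroup h '' Subgroup.connectedComponentOfOne (GR ψ) with hS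
  have hpre : X.ofGroup h ⁻¹' S = Subgroup.connectedComponentOfOne (GR ψ) := by
    refine Set.Subset.antisymm ?_ (Set.subset_preimage_image _ _)
    rintro g ⟨k, hk, hkg⟩
    have h1 : X.ofGroup h (k⁻¹ * g) = X.ofGroup h 1 := by
      rw [← X.smul_ofGroup, ← hkg, X.smul_ofGroup, inv_mul_cancel]
    rw [X.ofGroup_one] at h1
    have h2 := mul_mem hk (hstab _ (congrArg Subtype.val h1))
    rwa [mul_inv_cancel_left] at h2
  have hclopen : IsClopen S := by
    refine ⟨⟨isOpen_coinduced.2 ?_⟩, isOpen_coinduced.2 ?_⟩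
    · rw [Set.preimage_compl, hpre]
      exact (Subgroup.isClosed_of_isOpen _ hopen).isOpen_compl
    · rwa [hpre]
  have hX : Xplus h = S := by
    refine Set.Subset.antisymm ?_ ?_
    · exact hclopen.connectedComponent_subset ⟨1, one_mem _, X.ofGroup_one⟩
    · exact (isPreconnected_connectedComponent.image _
        X.continuous_ofGroup.continuousOn).subset_connectedComponent
          ⟨1, mem_connectedComponent, X.ofGroup_one⟩
  rw [hX, ← Set.mem_preimage, hpre]
  rfl

lemma isOpen_Xplus (hopen : IsOpen (Subgroup.connectedComponentOfOne (GR ψ) : Set (GR ψ)))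
    (hstab : ∀ g : GR ψ, (MulAut.conj g).toMonoidHom.comp h = h →
      g ∈ Subgroup.connectedComponentOfOne (GR ψ)) : IsOpen (Xplus h) := by
  refine isOpen_coinduced.2 ?_
  convert! hopen using 1
  ext g
  exact ofGroup_mem_Xplus_iff hopen hstab g

lemma mem_GQplus_of_smul_mem
    (hopen : IsOpen (Subgroup.connectedComponentOfOne (GR ψ) : Set (GR ψ)))
    (hstab : ∀ g : GR ψ, (MulAut.conj g).toMonoidHom.comp h = h →
      g ∈ Subgroup.connectedComponentOfOne (GR ψ)) {q : GQ ψ} {x : X h} (hx : x ∈ Xplus h)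
    (hqx : q • x ∈ Xplus h) : q ∈ GQplus ψ := by
  obtain ⟨g, rfl⟩ := X.exists_ofGroup x
  rw [X.toReal_smul, X.smul_ofGroup, ofGroup_mem_Xplus_iff hopen hstab] at hqx
  rw [ofGroup_mem_Xplus_iff hopen hstab] at hx
  have := mul_mem hqx (inv_mem hx)
  rwa [mul_inv_cancel_right] at this

lemma Sh.isOpenMap_mk : IsOpenMap fun p : X h × GAf ψ => Sh.mk h p.1 p.2 := by
  have : ContinuousConstSMul (GQ ψ) (X h × GAf ψ) := ⟨fun q => by
    have h1 : Continuous fun p : X h × GAf ψ => (toReal ψ q • p.1, toAdelic ψ q * p.2) :=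
      ((X.continuous_smul _).comp continuous_fst).prodMk
        ((continuous_const_mul _).comp continuous_snd)
    exact h1⟩
  exact isOpenMap_quotient_mk'_mul

lemma Sh.continuous_smul (g : GAf ψ) : Continuous fun s : Sh h => g • s := by
  have h1 : Continuous fun p : X h × GAf ψ => Sh.mk h p.1 (p.2 * g⁻¹) :=
    Sh.continuous_mk.comp (continuous_fst.prodMk ((continuous_mul_const _).comp continuous_snd))
  exact h1.quotient_lift _

lemma U.continuous_smul (γ : Gamma ψ L × Gamma ψ L) : Continuous fun u : U L h => γ • u := by
  have hv : Continuous fun u : U L h => u.1 := continuous_subtype_val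
  have h1 : Continuous fun u : U L h => (γ.1 : GAf ψ) * u.1.1 * (γ.2 : GAf ψ)⁻¹ :=
    (continuous_mul_const _).comp ((continuous_const_mul _).comp (continuous_fst.comp hv))
  have h2 : Continuous fun u : U L h => Gamma.toGammaM L γ.2 * u.1.2.1 :=
    (continuous_const_mul _).comp (continuous_fst.comp (continuous_snd.comp hv))
  have h3 : Continuous fun u : U L h => (γ.2 : GAf ψ) • u.1.2.2 :=
    (Sh.continuous_smul _).comp (continuous_snd.comp (continuous_snd.comp hv))
  exact Continuous.subtype_mk (h1.prodMk (h2.prodMk h3)) _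

lemma continuous_naturalU : Continuous (naturalU L h) := by
  have hv : Continuous fun u : Uplus L h => u.1 := continuous_subtype_val
  have h1 : Continuous fun u : Uplus L h => toAdelic ψ (u.1.1 : GQ ψ) :=
    (continuous_of_discreteTopology (f := fun q : GQplus ψ => toAdelic ψ (q : GQ ψ))).comp
      (continuous_fst.comp hv)
  have h2 : Continuous fun u : Uplus L h => u.1.2.1 :=
    continuous_fst.comp (continuous_snd.comp hv)
  have h3 : Continuous fun u : Uplus L h => Sh.mk h (u.1.2.2 : X h) 1 :=
    Sh.continuous_mk.comp ((continuous_subtype_val.comp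
      (continuous_snd.comp (continuous_snd.comp hv))).prodMk continuous_const)
  exact Continuous.subtype_mk (h1.prodMk (h2.prodMk h3)) _

lemma continuous_naturalZ : Continuous (naturalZ L h) :=
  (continuous_quotient_mk'.comp continuous_naturalU).quotient_lift _

/-- If two points of U⁺ become equivalent under (γ₁, γ₂), equality in Sh yields a rational q with
image γ₂⁻¹ that moves one point of X⁺ to the other. So γ₂ comes from GSp(ℚ)⁺, and then γ₁ does too.
-/
lemma naturalZ_injective
    (hopen : IsOpen (Subgroup.connectedComponentOfOne (GR ψ) : Set (GR ψ)))
    (hstab : ∀ g : GR ψ, (MulAut.conj g).toMonoidHom.comp h = h →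
      g ∈ Subgroup.connectedComponentOfOne (GR ψ)) : Function.Injective (naturalZ L h) := by
  intro a b hab
  obtain ⟨u, rfl⟩ := Quotient.exists_rep a
  obtain ⟨v, rfl⟩ := Quotient.exists_rep b
  obtain ⟨⟨γ₁, γ₂⟩, hγ⟩ := Z.mk_eq_iff.1 hab
  have h1 : (γ₁ : GAf ψ) * toAdelic ψ v.1.1 * (γ₂ : GAf ψ)⁻¹ = toAdelic ψ u.1.1 :=
    congrArg (fun w : U L h => w.1.1) hγ
  have h2 : Gamma.toGammaM L γ₂ * v.1.2.1 = u.1.2.1 := congrArg (fun w : U L h => w.1.2.1) hγ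
  have h3 : Sh.mk h v.1.2.2 (1 * (γ₂ : GAf ψ)⁻¹) = Sh.mk h u.1.2.2 1 :=
    congrArg (fun w : U L h => w.1.2.2) hγ
  obtain ⟨q, hq⟩ := Quotient.exact h3
  have hqx : q • (u.1.2.2 : X h) = v.1.2.2 := congrArg Prod.fst hq
  have hqγ : toAdelic ψ q = (γ₂ : GAf ψ)⁻¹ := by
    have := congrArg Prod.snd hq
    change toAdelic ψ q * 1 = 1 * (γ₂ : GAf ψ)⁻¹ at this
    rwa [mul_one, one_mul] at this
  have hqp : q ∈ GQplus ψ :=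
    mem_GQplus_of_smul_mem hopen hstab u.1.2.2.2 (hqx ▸ v.1.2.2.2)
  let q' : GQplus ψ := ⟨q, hqp⟩
  have hγ₂ : toAdelic ψ (q'⁻¹ : GQplus ψ) = (γ₂ : GAf ψ) := by
    change toAdelic ψ q⁻¹ = _
    rw [map_inv, hqγ, inv_inv]
  -- The first coordinates give γ₁ = g_u γ₂ g_v⁻¹, a product of images of elements of GSp(ℚ)⁺.
  have hγ₁ : toAdelic ψ (u.1.1 * q'⁻¹ * v.1.1⁻¹ : GQplus ψ) = (γ₁ : GAf ψ) := by
    rw [Subgroup.coe_mul, Subgroup.coe_mul, map_mul, map_mul, hγ₂, Subgroup.coe_inv, map_inv, ← h1]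
    group
  let δ₁ : GammaPlus ψ L := ⟨u.1.1 * q'⁻¹ * v.1.1⁻¹, by
    change toAdelic ψ (u.1.1 * q'⁻¹ * v.1.1⁻¹ : GQplus ψ) ∈ Gamma ψ L
    rw [hγ₁]; exact γ₁.2⟩
  let δ₂ : GammaPlus ψ L := ⟨q'⁻¹, by
    change toAdelic ψ (q'⁻¹ : GQplus ψ) ∈ Gamma ψ L
    rw [hγ₂]; exact γ₂.2⟩
  refine Quotient.sound ⟨(δ₁, δ₂), Subtype.ext (Prod.ext ?_ (Prod.ext ?_ ?_))⟩
  · change u.1.1 * q'⁻¹ * v.1.1⁻¹ * v.1.1 * (q'⁻¹)⁻¹ = u.1.1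
    group
  · change Gamma.toGammaM L (GammaPlus.toGamma L δ₂) * v.1.2.1 = u.1.2.1
    rw [show GammaPlus.toGamma L δ₂ = γ₂ from Subtype.ext hγ₂, h2]
  · refine Subtype.ext ?_
    change q⁻¹ • (v.1.2.2 : X h) = u.1.2.2
    rw [← hqx, inv_smul_smul]

/-- In a decomposition g = qγ the pair (q, γ) may be replaced by (qs⁻¹, sγ). This corrects the
component of q⁻¹k when necessary. -/
lemma exists_GQplus_mul_Gamma
    (hclass : ∀ g : GAf ψ, ∃ q : GQ ψ, ∃ γ ∈ Gamma ψ L, g = toAdelic ψ q * γ)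
    {s : GQ ψ} (hs : toAdelic ψ s ∈ Gamma ψ L)
    (hs' : ∀ g : GR ψ, g ∉ Subgroup.connectedComponentOfOne (GR ψ) →
      toReal ψ s * g ∈ Subgroup.connectedComponentOfOne (GR ψ)) (g : GAf ψ) (k : GR ψ) :
    ∃ q : GQ ψ, ∃ γ ∈ Gamma ψ L, g = toAdelic ψ q * γ ∧
      toReal ψ q⁻¹ * k ∈ Subgroup.connectedComponentOfOne (GR ψ) := by
  obtain ⟨q, γ, hγ, rfl⟩ := hclass g
  by_cases hq : toReal ψ q⁻¹ * k ∈ Subgroup.connectedComponentOfOne (GR ψ)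
  · exact ⟨q, γ, hγ, rfl, hq⟩
  · refine ⟨q * s⁻¹, toAdelic ψ s * γ, mul_mem hs hγ, ?_, ?_⟩
    · rw [map_mul, map_inv]
      group
    · rw [mul_inv_rev, inv_inv, map_mul, mul_assoc]
      exact hs' _ hq

lemma naturalZ_surjective
    (hopen : IsOpen (Subgroup.connectedComponentOfOne (GR ψ) : Set (GR ψ)))
    (hstab : ∀ g : GR ψ, (MulAut.conj g).toMonoidHom.comp h = h →
      g ∈ Subgroup.connectedComponentOfOne (GR ψ))
    (hclass : ∀ g : GAf ψ, ∃ q : GQ ψ, ∃ γ ∈ Gamma ψ L, g = toAdelic ψ q * γ)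
    {s : GQ ψ} (hs : toAdelic ψ s ∈ Gamma ψ L)
    (hs' : ∀ g : GR ψ, g ∉ Subgroup.connectedComponentOfOne (GR ψ) →
      toReal ψ s * g ∈ Subgroup.connectedComponentOfOne (GR ψ)) :
    Function.Surjective (naturalZ L h) := by
  intro z
  obtain ⟨⟨⟨g, ρ, t⟩, hu⟩, rfl⟩ := Quotient.exists_rep z
  obtain ⟨⟨x, l⟩, rfl⟩ := Quotient.exists_rep t
  obtain ⟨k, rfl⟩ := X.exists_ofGroup x
  -- Acting by γ turns [x, qγ] into [x, q] = [q⁻¹x, 1], with q⁻¹x in X⁺.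
  obtain ⟨q, γ, hγ, rfl, hq⟩ := exists_GQplus_mul_Gamma hclass hs hs' l k
  -- The inverse is decomposed because the factor from Γ is needed on the left: (gγ⁻¹)⁻¹ = rδ gives
  -- δgγ⁻¹ = r⁻¹.
  obtain ⟨r, δ, hδ, hg, hr⟩ := exists_GQplus_mul_Gamma hclass hs hs' (g * γ⁻¹)⁻¹ 1
  rw [mul_one] at hr
  have hg' : δ * g * γ⁻¹ = toAdelic ψ r⁻¹ := by
    have h1 : g = δ⁻¹ * (toAdelic ψ r)⁻¹ * γ := by
      rw [inv_eq_iff_eq_inv, mul_inv_rev, mul_inv_eq_iff_eq_mul] at hg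
      exact hg
    rw [h1, map_inv]
    group
  set u : U L h := ⟨(g, ρ, Sh.mk h (X.ofGroup h k) (toAdelic ψ q * γ)), hu⟩ with hudef
  let η : Gamma ψ L × Gamma ψ L := (⟨δ, hδ⟩, ⟨γ, hγ⟩)
  have hmem := (η • u).2
  let w : Uplus L h := ⟨(⟨r⁻¹, hr⟩, Gamma.toGammaM L ⟨γ, hγ⟩ * ρ, ⟨q⁻¹ • X.ofGroup h k, by
    rw [X.toReal_smul, X.smul_ofGroup, ofGroup_mem_Xplus_iff hopen hstab]
    exact hq⟩), by
      change GAf.toEnd ψ (δ * g * γ⁻¹) * _ ∈ GammaM ψ L at hmem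
      rw [hg'] at hmem
      exact hmem⟩
  have hw : naturalU L h w = η • u := by
    refine Subtype.ext (Prod.ext hg'.symm (Prod.ext rfl ?_))
    change Sh.mk h (q⁻¹ • X.ofGroup h k) 1 = Sh.mk h (X.ofGroup h k) (toAdelic ψ q * γ * γ⁻¹)
    rw [← Sh.mk_smul h q, smul_inv_smul, mul_one, mul_inv_cancel_right]
  exact ⟨Zplus.mk w, by rw [naturalZ_mk, hw, Z.mk_smul]; rfl⟩

lemma naturalZ_isOpenMap
    (hopen : IsOpen (Subgroup.connectedComponentOfOne (GR ψ) : Set (GR ψ)))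
    (hstab : ∀ g : GR ψ, (MulAut.conj g).toMonoidHom.comp h = h →
      g ∈ Subgroup.connectedComponentOfOne (GR ψ))
    (hΓ : IsOpen (Gamma ψ L : Set (GAf ψ))) : IsOpenMap (naturalZ L h) := by
  intro O hO
  have hO' : IsOpen (Zplus.mk ⁻¹' O : Set (Uplus L h)) := hO.preimage continuous_quotient_mk'
  suffices hP : IsOpen (Z.mk ⁻¹' (naturalZ L h '' O) : Set (U L h)) from
    isOpen_coinduced.2 hP
  rw [isOpen_iff_mem_nhds]
  rintro u ⟨z, hz, hzu⟩
  obtain ⟨w, rfl⟩ := Quotient.exists_rep z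
  obtain ⟨γ, hγ⟩ := Z.mk_eq_iff.1 hzu
  -- The set is invariant under Γ × Γ, so a neighbourhood is needed only at the point `naturalU L h
  -- w`.
  have hpre : (fun v : U L h => γ • v) ⁻¹' (Z.mk ⁻¹' (naturalZ L h '' O)) =
      Z.mk ⁻¹' (naturalZ L h '' O) := by
    ext v
    rw [Set.mem_preimage, Set.mem_preimage, Set.mem_preimage, Z.mk_smul]
  rw [← hpre]
  refine (U.continuous_smul γ).continuousAt ?_
  rw [hγ]
  obtain ⟨O₁, hO₁, hO₁'⟩ := isOpen_induced_iff.1 hO'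
  -- The slice of O₁ at the fixed first coordinate of w. It is open in Γ_M × X because X⁺ is open in
  -- X.
  let T : Set (GammaM ψ L × X h) := Prod.map id Subtype.val ''
    ((fun p : GammaM ψ L × Xplus h => (w.1.1, p.1, p.2)) ⁻¹' O₁)
  have hT : IsOpen T :=
    (IsOpenMap.id.prodMap (isOpen_Xplus hopen hstab).isOpenMap_subtype_val) _
      (hO₁.preimage (continuous_const.prodMk (continuous_fst.prodMk continuous_snd)))
  let m : GAf ψ × GammaM ψ L × (X h × Gamma ψ L) → GAf ψ × GammaM ψ L × Sh h :=
    fun p => (p.1, p.2.1, Sh.mk h p.2.2.1 p.2.2.2)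
  have hm : IsOpenMap m := IsOpenMap.id.prodMap (IsOpenMap.id.prodMap
    (Sh.isOpenMap_mk.comp (IsOpenMap.id.prodMap hΓ.isOpenMap_subtype_val)))
  -- `Q` describes the points (g, ρ, [x, l]) with l ∈ Γ that an element of Γ × Γ moves to the image
  -- of (w.1.1, lρ, x). It is open, and so is its image under `m`.
  let Q : Set (GAf ψ × GammaM ψ L × (X h × Gamma ψ L)) :=
    {p | p.1 * (p.2.2.2 : GAf ψ)⁻¹ * (toAdelic ψ w.1.1)⁻¹ ∈ Gamma ψ L ∧
      (Gamma.toGammaM L p.2.2.2 * p.2.1, p.2.2.1) ∈ T}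
  have hQ : IsOpen Q := by
    have hl : Continuous fun p : GAf ψ × GammaM ψ L × (X h × Gamma ψ L) => p.2.2.2 :=
      continuous_snd.comp (continuous_snd.comp continuous_snd)
    refine (hΓ.preimage ?_).inter (hT.preimage ?_)
    · exact (continuous_fst.mul (continuous_subtype_val.comp hl).inv).mul continuous_const
    · exact ((Gamma.continuous_toGammaM.comp hl).mul (continuous_fst.comp continuous_snd)).prodMk
        (continuous_fst.comp (continuous_snd.comp continuous_snd))
  have hval : Continuous fun v : U L h => v.1 := continuous_subtype_val
  refine Filter.mem_of_superset (((hm Q hQ).preimage hval).mem_nhds ?_) ?_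
  · refine ⟨(toAdelic ψ w.1.1, w.1.2.1, w.1.2.2, 1), ⟨?_, ?_⟩, rfl⟩
    · simp only [Subgroup.coe_one, inv_one, mul_one, mul_inv_cancel]
      exact one_mem _
    · refine ⟨(w.1.2.1, w.1.2.2), ?_, ?_⟩
      · have : w ∈ Subtype.val ⁻¹' O₁ := hO₁' ▸ hz
        exact this
      · rfl
  · rintro ⟨v, hv⟩ ⟨⟨g, ρ, x, l⟩, ⟨hg, ⟨⟨ρ', x'⟩, hT', hT''⟩⟩, hgv⟩
    change m (g, ρ, x, l) = v at hgv
    subst hgv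
    obtain ⟨rfl, rfl⟩ : ρ' = Gamma.toGammaM L l * ρ ∧ (x' : X h) = x :=
      ⟨congrArg Prod.fst hT'', congrArg Prod.snd hT''⟩
    -- The second component l brings [x, l] to [x, 1]; the first then brings gl⁻¹ to the rational
    -- element of w.
    let η : Gamma ψ L × Gamma ψ L := (⟨_, inv_mem hg⟩, l)
    have hη : (g * (l : GAf ψ)⁻¹ * (toAdelic ψ w.1.1)⁻¹)⁻¹ * g * (l : GAf ψ)⁻¹ =
        toAdelic ψ w.1.1 := by group
    let v : U L h := ⟨m (g, ρ, x', l), hv⟩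
    have hmem := (η • v).2
    let w' : Uplus L h := ⟨(w.1.1, Gamma.toGammaM L l * ρ, x'), by
      change GAf.toEnd ψ ((g * (l : GAf ψ)⁻¹ * (toAdelic ψ w.1.1)⁻¹)⁻¹ * g * (l : GAf ψ)⁻¹) * _ ∈
        GammaM ψ L at hmem
      rw [hη] at hmem
      exact hmem⟩
    have hw' : w' ∈ Zplus.mk ⁻¹' O := by
      rw [← hO₁']
      exact hT'
    refine ⟨Zplus.mk w', hw', ?_⟩
    have hn : naturalU L h w' = η • v := by
      refine Subtype.ext (Prod.ext hη.symm (Prod.ext rfl ?_))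
      change Sh.mk h x' 1 = Sh.mk h x' ((l : GAf ψ) * (l : GAf ψ)⁻¹)
      rw [mul_inv_cancel]
    rw [naturalZ_mk, hn, Z.mk_smul]

end Comparison

/-! ### Rational similitudes with multiplier -1, and the main theorem -/

lemma baseChange_toReal_of_neg {V : Type*} [AddCommGroup V] [Module ℚ V] [Module.Finite ℚ V]
    {ψ : LinearMap.BilinForm ℚ V} {s : GQ ψ}
    (hs : ∀ x y, ψ ((s.1 : Module.End ℚ V) x) ((s.1 : Module.End ℚ V) y) = -ψ x y)
    (x y : ℝ ⊗[ℚ] V) :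
    ψ.baseChange ℝ (((toReal ψ s).1 : Module.End ℝ (ℝ ⊗[ℚ] V)) x)
      (((toReal ψ s).1 : Module.End ℝ (ℝ ⊗[ℚ] V)) y) = -ψ.baseChange ℝ x y := by
  induction x using TensorProduct.induction_on with
  | zero => simp
  | add x₁ x₂ h₁ h₂ => simp only [map_add, LinearMap.add_apply, h₁, h₂, neg_add]
  | tmul a m =>
    induction y using TensorProduct.induction_on with
    | zero => simp
    | add y₁ y₂ h₁ h₂ => simp only [map_add, h₁, h₂, neg_add]
    | tmul b n =>
      change ψ.baseChange ℝ (a ⊗ₜ[ℚ] (s.1 : Module.End ℚ V) m)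
        (b ⊗ₜ[ℚ] (s.1 : Module.End ℚ V) n) = _
      simp only [LinearMap.BilinForm.baseChange_tmul, hs, neg_smul]

lemma mul_mem_connectedComponentOfOne_of_neg {V : Type*} [AddCommGroup V] [Module ℚ V]
    [Module.Finite ℚ V] {ψ : LinearMap.BilinForm ℚ V} (hR : (ψ.baseChange ℝ).IsAlt)
    (hn : ∀ x, (∀ y, ψ.baseChange ℝ x y = 0) → x = 0) {x y : ℝ ⊗[ℚ] V}
    (hxy : 0 < ψ.baseChange ℝ x y) {s : GQ ψ}
    (hs : ∀ x y, ψ ((s.1 : Module.End ℚ V) x) ((s.1 : Module.End ℚ V) y) = -ψ x y)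
    (g : GR ψ) (hg : g ∉ Subgroup.connectedComponentOfOne (GR ψ)) :
    toReal ψ s * g ∈ Subgroup.connectedComponentOfOne (GR ψ) := by
  rw [mem_connectedComponentOfOne_iff hR hn hxy] at hg ⊢
  obtain ⟨ν, hν⟩ := g.2
  have h1 : ψ.baseChange ℝ ((g.1 : Module.End ℝ (ℝ ⊗[ℚ] V)) x)
      ((g.1 : Module.End ℝ (ℝ ⊗[ℚ] V)) y) ≠ 0 := by
    rw [hν]
    exact mul_ne_zero ν.ne_zero hxy.ne'
  have h2 := baseChange_toReal_of_neg hs ((g.1 : Module.End ℝ (ℝ ⊗[ℚ] V)) x)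
    ((g.1 : Module.End ℝ (ℝ ⊗[ℚ] V)) y)
  exact lt_of_lt_of_eq (neg_pos.2 (lt_of_le_of_ne (not_lt.1 hg) h1)) h2.symm

end ShimuraBCM

open ShimuraBCM in
theorem mainTheorem4 {ι : Type*} [Fintype ι] [DecidableEq ι] [Nonempty ι]
    (E : ι → Type*) [∀ i, Field (E i)] [∀ i, NumberField (E i)] [∀ i, IsCMField (E i)]
    (Φ : ∀ i, CMType (E i)) (ξ : ∀ i, E i)
    (hgen : ∀ i, IntermediateField.adjoin ℚ {ξ i} = ⊤)
    (himag : ∀ i, IsCMField.complexConj (E i) (ξ i) = -ξ i)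
    (hpol : (∀ i, ∀ φ ∈ (Φ i).carrier, 0 < (φ (ξ i)).im) ∨
      (∀ i, ∀ φ ∈ (Φ i).carrier, (φ (ξ i)).im < 0)) :
    (∀ g : GAf (psi ξ), ∃ q : GQ (psi ξ), ∃ γ ∈ Gamma (psi ξ) (latticeO E),
        g = toAdelic (psi ξ) q * γ) ∧
    (Function.Surjective fun q : (Gamma (psi ξ) (latticeO E)).comap (toAdelic (psi ξ)) =>
        (QuotientGroup.mk (q : GQ (psi ξ)) : GQ (psi ξ) ⧸ GQplus (psi ξ))) ∧
    IsHomeomorph (naturalZ (latticeO E) (hcm Φ ξ)) := by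
  obtain ⟨ε, hε⟩ := exists_pos_mul_psi_hAlg Φ ξ hpol
  have hψ := psi_isAlt Φ ξ himag
  have hR := psi_baseChange_isAlt Φ ξ himag
  have hn := psi_nondegenerate hε
  have hnR := psi_baseChange_nondegenerate hε
  obtain ⟨x, y, hxy⟩ := exists_psi_baseChange_pos hε
  have hL := isLattice_latticeO (E := E)
  have hmem := mem_connectedComponentOfOne_iff hR hnR hxy
  have hopen : IsOpen (Subgroup.connectedComponentOfOne (GR (psi ξ)) : Set (GR (psi ξ))) := by
    convert! (isClopen_pos hxy.ne').isOpen using 1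
    ext g
    exact hmem g
  have hstab : ∀ g : GR (psi ξ), (MulAut.conj g).toMonoidHom.comp (hcm Φ ξ) = hcm Φ ξ →
      g ∈ Subgroup.connectedComponentOfOne (GR (psi ξ)) :=
    fun g hg => (hmem g).2 (pos_of_conj_hcm_eq hε hg hxy)
  obtain ⟨s, hs, hsneg⟩ := exists_GQ_neg_mem_Gamma hψ hn hL
  have hs' := mul_mem_connectedComponentOfOne_of_neg hR hnR hxy hsneg
  have hclass := exists_GQ_mul_Gamma hψ hn hL
  refine ⟨hclass, fun t => ?_, continuous_naturalZ,
    naturalZ_isOpenMap hopen hstab (isOpen_Gamma hL),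
    naturalZ_injective hopen hstab, naturalZ_surjective hopen hstab hclass hs hs'⟩
  obtain ⟨q, rfl⟩ := QuotientGroup.mk_surjective t
  by_cases hq : toReal (psi ξ) q ∈ Subgroup.connectedComponentOfOne (GR (psi ξ))
  · refine ⟨1, QuotientGroup.eq.2 ?_⟩
    rw [Subgroup.coe_one, inv_one, one_mul]
    exact hq
  -- Left cosets of a and b agree when a⁻¹b lies in the subgroup. For a = s⁻¹ this is sq, whose
  -- multiplier is positive.
  · refine ⟨⟨s⁻¹, inv_mem hs⟩, QuotientGroup.eq.2 ?_⟩
    rw [inv_inv]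
    change toReal (psi ξ) (s * q) ∈ Subgroup.connectedComponentOfOne (GR (psi ξ))
    rw [map_mul]
    exact hs' _ hq
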